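/- Let $E$ be a real Banach space with norm $|\cdot|$, let $T>0$, $I=[0,T]$ with Lebesgue measure, let $C(I,E)$ be the Banach space of continuous maps $I\to E$ with the maximum norm, let $p\in[1,\infty)$ and $q\in(1,\infty]$ with $\frac1p+\frac1q=1$. For $\Omega\subset E$ let $\beta(\Omega)$ be the Hausdorff measure of noncompactness, i.e. the infimum of all $\varepsilon>0$ such that $\Omega$ can be covered by finitely many balls of radius $\varepsilon$ ($\beta(\Omega)=\infty$ if there is no such $\varepsilon$). Let $F$ be a set-valued map assigning to every $(t,x)\in I\times E$ a subset $F(t,x)\subset E$ such that: * $(F_1)$ for all $t\in I$, $x\in E$ the set $F(t,x)$ is nonempty, closed and convex; if $p=1$, then moreover for almost all $t\in I$ the set $F(t,x)$ is weakly compact for all $x\in E$; * $(F_2)$ for every $x\in E$ the map $F(\cdot,x)$ has a strongly measurable selection; * $(F_3)$ for almost all $t\in I$ the map $F(t,\cdot)$ is upper hemicontinuous, i.e. for every $\varphi\in E^*$ the function $x\mapsto\sup_{y\in F(t,x)}\langle\varphi,y\rangle\in\mathbb R\cup\{+\infty\}$ is upper semicontinuous; * $(F_4)$ there is $c\in L^p(I,\mathbb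 R)$ such that for almost all $t\in I$, for all $x\in E$, $\sup\{|y| : y\in F(t,x)\}\le c(t)(1+|x|)$; * $(F_5)$ there is $\eta\in L^p(I,\mathbb R)$ such that for every bounded $\Omega\subset E$ and almost all $t\in I$, $\beta(F(t,\Omega))\le\eta(t)^+\beta(\Omega)$, where $F(t,\Omega)=\bigcup_{x\in\Omega}F(t,x)$ and $\eta^+=\max(\eta,0)$. Let $\mathcal L(E)$ be the space of bounded linear operators on $E$ with the operator norm, and let $k(t,s)\in\mathcal L(E)$ be given for $0\le s\le t\le T$ such that: * $(k_5)$ for every $t\in I$, $k(t,\cdot)\in L^q([0,t],\mathcal L(E))$; * $(k_6)$ the map $t\mapsto k(t,\cdot)$, where $k(t,\cdot)$ is extended by zero to $I$, is continuous from $I$ to $L^q(I,\mathcal L(E))$. For $h\in C(I,E)$ let $S_F^p(h)$ be the set of all $x\in C(I,E)$ for which there is $w\in L^p(I,E)$ with $w(t)\in F(t,x(t))$ for almost all $t\in I$ and $$x(t)=h(t)+\int_0^t k(t,s)w(s)\,ds\qquad\text{for all }t\in I.$$ Then $S_F^p$ is an upper semicontinuous set-valued map from $C(I,E)$ to $C(I,E)$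 with nonempty values: $S_F^p(h)\neq\emptyset$ for every $h\in C(I,E)$, and for every open set $A\subset C(I,E)$ the set $\{h\in C(I,E) : S_F^p(h)\subset A\}$ is open in $C(I,E)$. -/

import Mathlib

open MeasureTheory Filter Topology
open scoped ENNReal NNReal

namespace VolterraInclusion

noncomputable section

/-- The compact segment `I = [0, T]`. For `t : Segment T` the segment `[0, t]` is `Set.Iic t`. -/
abbrev Segment (T : ℝ) : Type := Set.Icc (0 : ℝ) T

/-- `I` carries the Lebesgue measure, pulled back along the inclusion `I ⊆ ℝ`. -/
instance (T : ℝ) : MeasureSpace (Segment T) := Measure.Subtype.measureSpace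

section Multimaps

variable {E : Type*} [NormedAddCommGroup E] [NormedSpace ℝ E]

/-- The support function `σ(φ, A) = sup_{y ∈ A} ⟨φ, y⟩`, with values in the extended reals. -/
def supportFun (φ : StrongDual ℝ E) (A : Set E) : EReal :=
  ⨆ y ∈ A, ((φ y : ℝ) : EReal)

/-- Upper hemicontinuity of a set-valued map through support functions: for every `φ ∈ E*`
the function `x ↦ σ(φ, G x)` is upper semicontinuous. -/
def IsUpperHemicontinuous (G : E → Set E) : Prop :=
  ∀ φ : StrongDual ℝ E, UpperSemicontinuous fun x => supportFun φ (G x)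

/-- Compactness in the weak topology of `E`. -/
def IsWeaklyCompact (A : Set E) : Prop :=
  IsCompact (toWeakSpace ℝ E '' A)

/-- The Hausdorff measure of noncompactness: the infimum of the radii `ε > 0` such that `Ω` is
covered by finitely many balls of radius `ε` (it is `∞` for unbounded `Ω`). -/
def hausdorffMNC (Ω : Set E) : ℝ≥0∞ :=
  ⨅ (ε : ℝ≥0) (_ : 0 < ε)
    (_ : ∃ s : Set E, s.Finite ∧ Ω ⊆ ⋃ c ∈ s, Metric.ball c (ε : ℝ)), (ε : ℝ≥0∞)

/-- Upper semicontinuity of a set-valued map between topological spaces: the small inverse image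
`{x | G x ⊆ A}` of every open set `A` is open. -/
def IsUpperSemicontinuous {X Y : Type*} [TopologicalSpace X] [TopologicalSpace Y]
    (G : X → Set Y) : Prop :=
  ∀ A : Set Y, IsOpen A → IsOpen {x | G x ⊆ A}

end Multimaps

section Hypotheses

variable {E : Type*} [NormedAddCommGroup E] [NormedSpace ℝ E] {T : ℝ}

/-- The hypotheses `(F₁)`-`(F₅)` on a set-valued map `F : I × E ⊸ E`, for the exponent `p`. -/
structure MultimapHypotheses (p : ℝ≥0∞) (F : Segment T → E → Set E) : Prop where
  nonempty : ∀ t x, (F t x).Nonempty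
  isClosed : ∀ t x, IsClosed (F t x)
  convex : ∀ t x, Convex ℝ (F t x)
  weaklyCompact : p = 1 → ∀ᵐ t, ∀ x, IsWeaklyCompact (F t x)
  selection : ∀ x, ∃ w : Segment T → E, AEStronglyMeasurable w volume ∧ ∀ t, w t ∈ F t x
  upperHemicontinuous : ∀ᵐ t, IsUpperHemicontinuous (F t)
  growth : ∃ c : Segment T → ℝ, MemLp c p volume ∧
    ∀ᵐ t, ∀ x, ∀ y ∈ F t x, ‖y‖ ≤ c t * (1 + ‖x‖)
  compactness : ∃ η : Segment T → ℝ, MemLp η p volume ∧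
    ∀ Ω : Set E, Bornology.IsBounded Ω →
      ∀ᵐ t, hausdorffMNC (⋃ x ∈ Ω, F t x) ≤ ENNReal.ofReal (η t) * hausdorffMNC Ω

/-- The section `k(t, ·) : [0, t] → 𝓛(E)`, extended by zero to the whole of `I`. The values of
`k` off the triangle `0 ≤ s ≤ t ≤ T` are not used. -/
def kernelSection (k : Segment T → Segment T → E →L[ℝ] E) (t : Segment T) :
    Segment T → E →L[ℝ] E :=
  (Set.Iic t).indicator (k t)

/-- The hypotheses `(k₅)`-`(k₆)` on a kernel: every section `k(t, ·)` is in `L^q([0, t], 𝓛(E))`,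
and `t ↦ k(t, ·)` is continuous in the norm of `L^q(I, 𝓛(E))`. -/
structure KernelHypotheses (q : ℝ≥0∞) (k : Segment T → Segment T → E →L[ℝ] E) : Prop where
  memLp : ∀ t, MemLp (k t) q (volume.restrict (Set.Iic t))
  continuous : ∀ t, Tendsto
    (fun τ => eLpNorm (kernelSection k τ - kernelSection k t) q volume) (𝓝 t) (𝓝 0)

end Hypotheses

section Solutions

variable {E : Type*} [NormedAddCommGroup E] [NormedSpace ℝ E] {T : ℝ}

/-- The Niemytskij operator `N_F^p(x) = {w ∈ L^p(I, E) | w(t) ∈ F(t, x(t)) for a.a. t}`. -/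
def niemytskij (p : ℝ≥0∞) (F : Segment T → E → Set E) (x : C(Segment T, E)) :
    Set (Lp E p (volume : Measure (Segment T))) :=
  {w | ∀ᵐ t, w t ∈ F t (x t)}

/-- The Volterra integral operator `V(w)(t) = ∫₀ᵗ k(t, s) w(s) ds`. -/
def volterra (k : Segment T → Segment T → E →L[ℝ] E) (w : Segment T → E) (t : Segment T) : E :=
  ∫ s in Set.Iic t, k t s (w s)

/-- The set `S_F^p(h) = {x ∈ C(I, E) | x ∈ h + V(N_F^p(x))}` of solutions of the integral
inclusion with inhomogeneity `h`. -/
def solutionSet (p : ℝ≥0∞) (F : Segment T → E → Set E) (k : Segment T → Segment T → E →L[ℝ] E)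
    (h : C(Segment T, E)) : Set C(Segment T, E) :=
  {x | ∃ w ∈ niemytskij p F x, ∀ t, x t = h t + volterra k w t}

end Solutions

end

end VolterraInclusion

/-!
Existence and upper semicontinuity both follow from one compactness statement about approximate
solutions `xₙ = hₙ + V wₙ` with `hₙ → h`, where `wₙ(t) ∈ F(t, xₙ(θₙ t))` and the delayed times
`θₙ t ≤ t` tend to `t` uniformly: a subsequence of `xₙ` converges uniformly to a solution for `h`.
With `θₙ = id` this says that solutions for `hₙ` accumulate at a solution for `h`, which gives upper
semicontinuity since `C(I, E)` is metrizable. With the delays `θ t = ⌊t / δ⌋ δ` approximate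
solutions can be constructed interval by interval from measurable selections of the maps `F(·, y)`, which
gives existence (`exists_delayed_selection_step`).

The compactness statement rests on the following points.

* Gronwall (`KernelHypotheses.exists_gronwall_const`): `t ↦ k(t, ·)` is uniformly continuous and
  `k(t₀, ·)` vanishes beyond `t₀`, so `∫_{t₀}^t ‖k(t, s)‖ b(s) ds` is small for `t` close to `t₀`.
  With the growth condition this bounds the `xₙ`, dominates the `wₙ` by one `L^p` function and makes
  the `xₙ` equicontinuous.
* A Heinz type inequality (`hausdorffMNC_integral_le`): `β{∫ K wₙ} ≤ 2 ∫ ‖K‖ β{wₙ(s)} ds`. Values in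
  a separable set are approximated by values in a finite set, and for those the set of integrals is
  totally bounded.
* For almost every `t`, `β{wₙ(t)} ≤ η⁺(t) β{xₙ(t)}` (`IsApproxSolution.ae_hausdorffMNC_le`). By the
  two previous points, `β{xₙ(t)} = 0` for all `t`, so the Arzelà-Ascoli theorem yields a uniformly
  convergent subsequence, and `{wₙ(t)}` is relatively compact for almost every `t`.
* Convex combinations of the tails of `wₙ` converge almost everywhere (`exists_ae_tendsto_combo`).
  Pairing with countably many functionals reduces this to norm convergence of such combinations in
  a Hilbert space, a consequence of the parallelogram identity. The limit is a selection of `F`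
  along the limit trajectory by the Hahn-Banach theorem and upper hemicontinuity
  (`IsUpperHemicontinuous.mem_of_tendsto_combo`).
-/

namespace VolterraInclusion

/-! ### The Hausdorff measure of noncompactness -/

section MNC

variable {E : Type*} [NormedAddCommGroup E]

theorem hausdorffMNC_le_of_finite_cover {Ω s : Set E} {r : ℝ≥0∞} (hs : s.Finite)
    (h : ∀ x ∈ Ω, ∃ c ∈ s, edist x c ≤ r) : hausdorffMNC Ω ≤ r := by
  refine le_of_forall_gt fun b hb => ?_
  obtain ⟨ε, hrε, hεb⟩ := ENNReal.lt_iff_exists_nnreal_btwn.1 hb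
  refine lt_of_le_of_lt ?_ hεb
  have hε : 0 < ε := by exact_mod_cast (zero_le.trans_lt hrε : (0 : ℝ≥0∞) < ε)
  refine iInf_le_of_le ε (iInf_le_of_le hε (iInf_le_of_le ⟨s, hs, fun x hx => ?_⟩ le_rfl))
  obtain ⟨c, hc, hxc⟩ := h x hx
  refine Set.mem_biUnion hc ?_
  have := hxc.trans_lt hrε
  rw [edist_nndist] at this
  rw [Metric.mem_ball]
  exact_mod_cast this

theorem exists_finite_cover_of_hausdorffMNC_lt {Ω : Set E} {r : ℝ≥0∞} (h : hausdorffMNC Ω < r) :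
    ∃ s : Set E, s.Finite ∧ ∀ x ∈ Ω, ∃ c ∈ s, edist x c < r := by
  simp only [hausdorffMNC, iInf_lt_iff] at h
  obtain ⟨ε, _, ⟨s, hs, hΩ⟩, hεr⟩ := h
  refine ⟨s, hs, fun x hx => ?_⟩
  obtain ⟨c, hc, hxc⟩ := Set.mem_iUnion₂.1 (hΩ hx)
  refine ⟨c, hc, lt_trans ?_ hεr⟩
  rw [Metric.mem_ball] at hxc
  rw [edist_nndist]
  exact_mod_cast hxc

theorem hausdorffMNC_le_of_forall_norm_le {A : Set E} {r : ℝ≥0∞} (h : ∀ x ∈ A, ‖x‖ₑ ≤ r) :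
    hausdorffMNC A ≤ r :=
  hausdorffMNC_le_of_finite_cover (Set.finite_singleton (0 : E)) fun x hx =>
    ⟨0, rfl, by simpa using h x hx⟩

theorem hausdorffMNC_eq_zero_iff {A : Set E} : hausdorffMNC A = 0 ↔ TotallyBounded A := by
  rw [EMetric.totallyBounded_iff]
  constructor
  · intro h ε hε
    obtain ⟨s, hs, hA⟩ := exists_finite_cover_of_hausdorffMNC_lt (h.trans_lt hε)
    refine ⟨s, hs, fun x hx => ?_⟩
    obtain ⟨c, hc, hxc⟩ := hA x hx
    exact Set.mem_biUnion hc hxc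
  · intro h
    refine le_antisymm (le_of_forall_gt fun r hr => ?_) zero_le
    obtain ⟨r', hr', hr''⟩ := exists_between hr
    obtain ⟨s, hs, hA⟩ := h r' hr'
    refine (hausdorffMNC_le_of_finite_cover hs fun x hx => ?_).trans_lt hr''
    obtain ⟨c, hc, hxc⟩ := Set.mem_iUnion₂.1 (hA hx)
    exact ⟨c, hc, le_of_lt hxc⟩

/-- Enlarging a set by at most `r` enlarges its measure of noncompactness by at most `r`, and a
totally bounded summand does not count. -/
theorem hausdorffMNC_le_add {A B P : Set E} {r : ℝ≥0∞} (hP : TotallyBounded P)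
    (h : ∀ x ∈ A, ∃ y ∈ B, ∃ z ∈ P, edist x (y + z) ≤ r) :
    hausdorffMNC A ≤ hausdorffMNC B + r := by
  refine ENNReal.le_of_forall_pos_le_add fun ε hε hfin => ?_
  have hε2 : (0 : ℝ≥0∞) < ε / 2 := by simpa using hε.ne'
  have hB : hausdorffMNC B < hausdorffMNC B + ε / 2 :=
    ENNReal.lt_add_right (ne_top_of_le_ne_top hfin.ne le_self_add) hε2.ne'
  obtain ⟨s, hs, hBs⟩ := exists_finite_cover_of_hausdorffMNC_lt hB
  obtain ⟨t, ht, hPt⟩ := exists_finite_cover_of_hausdorffMNC_lt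
    ((hausdorffMNC_eq_zero_iff.2 hP).trans_lt hε2)
  refine hausdorffMNC_le_of_finite_cover (hs.image2 (· + ·) ht) fun x hx => ?_
  obtain ⟨y, hy, z, hz, hxyz⟩ := h x hx
  obtain ⟨c, hc, hyc⟩ := hBs y hy
  obtain ⟨d, hd, hzd⟩ := hPt z hz
  refine ⟨c + d, Set.mem_image2_of_mem hc hd, ?_⟩
  calc edist x (c + d) ≤ edist x (y + z) + edist (y + z) (c + d) := edist_triangle _ _ _
    _ ≤ r + (edist y c + edist z d) := add_le_add hxyz (edist_add_add_le _ _ _ _)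
    _ ≤ r + (hausdorffMNC B + ε / 2 + ε / 2) := by gcongr
    _ = hausdorffMNC B + r + ε := by rw [add_assoc _ (_ / _), ENNReal.add_halves]; ring

theorem totallyBounded_of_subset_add {A B P : Set E} (hB : TotallyBounded B)
    (hP : TotallyBounded P) (h : ∀ x ∈ A, ∃ y ∈ B, ∃ z ∈ P, x = y + z) : TotallyBounded A := by
  rw [← hausdorffMNC_eq_zero_iff] at hB ⊢
  refine le_antisymm ((hausdorffMNC_le_add (r := 0) hP fun x hx => ?_).trans_eq
    (by rw [hB, add_zero])) zero_le
  obtain ⟨y, hy, z, hz, rfl⟩ := h x hx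
  exact ⟨y, hy, z, hz, by simp⟩

/-- Finitely many terms of a sequence do not influence its measure of noncompactness. -/
theorem hausdorffMNC_range_le_of_tail {u : ℕ → E} {B : Set E} {N : ℕ} (h : ∀ n ≥ N, u n ∈ B) :
    hausdorffMNC (Set.range u) ≤ hausdorffMNC B := by
  refine le_of_forall_gt fun r hr => ?_
  obtain ⟨r', hr', hr''⟩ := exists_between hr
  obtain ⟨s, hs, hB⟩ := exists_finite_cover_of_hausdorffMNC_lt hr'
  refine (hausdorffMNC_le_of_finite_cover
    (hs.union ((Set.finite_lt_nat N).image u)) ?_).trans_lt hr''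
  rintro _ ⟨n, rfl⟩
  rcases lt_or_ge n N with hn | hn
  · exact ⟨u n, Or.inr ⟨n, hn, rfl⟩, by simp⟩
  · obtain ⟨c, hc, hxc⟩ := hB _ (h n hn)
    exact ⟨c, Or.inl hc, hxc.le⟩

end MNC

/-! ### Convergent convex combinations of the tails of a sequence -/

section TailWeights

/-- A sequence of coefficient families of convex combinations: the `n`-th family is carried by
finitely many indices `m ≥ n`. -/
structure IsTailWeights (c : ℕ → ℕ →₀ ℝ) : Prop where
  nonneg : ∀ n m, 0 ≤ c n m
  le_of_mem : ∀ n, ∀ m ∈ (c n).support, n ≤ m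
  sum_eq_one : ∀ n, ∑ m ∈ (c n).support, c n m = 1

/-- The convex combination of the terms of `u` with coefficients `c`. -/
noncomputable def combo {V : Type*} [AddCommGroup V] [Module ℝ V] (c : ℕ →₀ ℝ) (u : ℕ → V) : V :=
  ∑ m ∈ c.support, c m • u m

namespace IsTailWeights

variable {c : ℕ → ℕ →₀ ℝ} {V : Type*} [AddCommGroup V] [Module ℝ V]

theorem comp (hc : IsTailWeights c) {ψ : ℕ → ℕ} (hψ : StrictMono ψ) :
    IsTailWeights fun n => c (ψ n) :=
  ⟨fun _ _ => hc.nonneg _ _, fun n m hm => (hψ.id_le n).trans (hc.le_of_mem _ m hm),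
    fun _ => hc.sum_eq_one _⟩

theorem combo_mem (hc : IsTailWeights c) {u : ℕ → V} {S : Set V} (hS : Convex ℝ S) (n : ℕ)
    (h : ∀ m ≥ n, u m ∈ S) : combo (c n) u ∈ S :=
  hS.sum_mem (fun _ _ => hc.nonneg _ _) (hc.sum_eq_one n) fun m hm => h m (hc.le_of_mem n m hm)

theorem tendsto_combo {W : Type*} [NormedAddCommGroup W] [NormedSpace ℝ W]
    (hc : IsTailWeights c) {u : ℕ → W} {x : W} (hu : Tendsto u atTop (𝓝 x)) :
    Tendsto (fun n => combo (c n) u) atTop (𝓝 x) := by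
  rw [Metric.tendsto_atTop] at hu ⊢
  intro ε hε
  obtain ⟨N, hN⟩ := hu ε hε
  exact ⟨N, fun n hn => hc.combo_mem (convex_ball x ε) n fun m hm => hN m (hn.trans hm)⟩

end IsTailWeights

theorem map_combo {V W : Type*} [AddCommGroup V] [Module ℝ V] [AddCommGroup W] [Module ℝ W]
    (L : V →ₗ[ℝ] W) (c : ℕ →₀ ℝ) (u : ℕ → V) : L (combo c u) = combo c fun m => L (u m) := by
  simp [combo, map_sum]

/-- In a Hilbert space every bounded sequence has norm convergent convex combinations of its tails:
almost minimizers of the norm over the convex hulls of the tails form a Cauchy sequence, by the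
parallelogram identity. -/
theorem exists_isTailWeights_tendsto {H : Type*} [NormedAddCommGroup H] [InnerProductSpace ℝ H]
    [CompleteSpace H] {u : ℕ → H} {M : ℝ} (hu : ∀ n, ‖u n‖ ≤ M) :
    ∃ c, IsTailWeights c ∧ ∃ x, Tendsto (fun n => combo (c n) u) atTop (𝓝 x) := by
  let C : ℕ → Set H := fun n => convexHull ℝ (u '' Set.Ici n)
  have hCanti : Antitone C := fun m n hmn =>
    convexHull_mono (Set.image_mono (Set.Ici_subset_Ici.2 hmn))
  have hne : ∀ n, ((‖·‖) '' C n).Nonempty := fun n =>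
    ⟨_, u n, subset_convexHull ℝ _ ⟨n, le_refl n, rfl⟩, rfl⟩
  have hbdd : ∀ n, BddBelow ((‖·‖) '' C n) := fun n =>
    ⟨0, by rintro _ ⟨z, _, rfl⟩; exact norm_nonneg z⟩
  let r : ℕ → ℝ := fun n => sInf ((‖·‖) '' C n)
  have hr_le : ∀ n, ∀ z ∈ C n, r n ≤ ‖z‖ := fun n z hz => csInf_le (hbdd n) ⟨z, hz, rfl⟩
  have hr0 : ∀ n, 0 ≤ r n := fun n =>
    le_csInf (hne n) (by rintro _ ⟨z, _, rfl⟩; exact norm_nonneg z)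
  have hrM : ∀ n, r n ≤ M := fun n =>
    (hr_le n (u n) (subset_convexHull ℝ _ ⟨n, le_refl n, rfl⟩)).trans (hu n)
  have hrmono : Monotone r := fun m n hmn =>
    csInf_le_csInf (hbdd m) (hne n) (Set.image_mono (hCanti hmn))
  obtain ⟨R, hR⟩ : ∃ R, Tendsto r atTop (𝓝 R) :=
    ⟨_, tendsto_atTop_ciSup hrmono ⟨M, by rintro _ ⟨n, rfl⟩; exact hrM n⟩⟩
  let e : ℕ → ℝ := fun n => 1 / ((n : ℝ) + 1)
  have he : Tendsto e atTop (𝓝 0) := tendsto_one_div_add_atTop_nhds_zero_nat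
  have hz : ∀ n, ∃ z ∈ C n, ‖z‖ < r n + e n := fun n => by
    obtain ⟨_, ⟨z, hz, rfl⟩, h⟩ := exists_lt_of_csInf_lt (hne n)
      (show sInf ((‖·‖) '' C n) < r n + e n from lt_add_of_pos_right _ Nat.one_div_pos_of_nat)
    exact ⟨z, hz, h⟩
  choose z hzC hzr using hz
  have hz_norm : Tendsto (fun n => ‖z n‖) atTop (𝓝 R) :=
    tendsto_of_tendsto_of_tendsto_of_le_of_le hR (by simpa using hR.add he)
      (fun n => hr_le n _ (hzC n)) fun n => (hzr n).le
  have hkey : ∀ N, ∀ m ≥ N, ∀ n ≥ N, ‖z m - z n‖ ^ 2 ≤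
      2 * ‖z m‖ ^ 2 + 2 * ‖z n‖ ^ 2 - 4 * r N ^ 2 := by
    intro N m hm n hn
    have hmid : (1 / 2 : ℝ) • z m + (1 / 2 : ℝ) • z n ∈ C N :=
      (convex_convexHull ℝ _) (hCanti hm (hzC m)) (hCanti hn (hzC n)) (by norm_num) (by norm_num)
        (by norm_num)
    have h1 := hr_le N _ hmid
    rw [← smul_add, norm_smul] at h1
    have h2 := parallelogram_law_with_norm ℝ (z m) (z n)
    norm_num at h1
    nlinarith [hr0 N]
  have hcauchy : CauchySeq z := by
    rw [Metric.cauchySeq_iff]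
    intro ε hε
    have hlim : Tendsto (fun N : ℕ => r N ^ 2) atTop (𝓝 (R ^ 2)) := hR.pow 2
    have hlim' : Tendsto (fun N : ℕ => ‖z N‖ ^ 2) atTop (𝓝 (R ^ 2)) := hz_norm.pow 2
    have hε' : 0 < ε ^ 2 / 16 := by positivity
    obtain ⟨N₁, h₁⟩ := Metric.tendsto_atTop.1 hlim _ hε'
    obtain ⟨N₂, h₂⟩ := Metric.tendsto_atTop.1 hlim' _ hε'
    refine ⟨max N₁ N₂, fun m hm n hn => ?_⟩
    rw [dist_eq_norm]
    refine lt_of_pow_lt_pow_left₀ 2 hε.le ?_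
    have a := abs_lt.1 (h₁ _ (le_max_left N₁ N₂))
    have b := abs_lt.1 (h₂ m ((le_max_right _ _).trans hm))
    have d := abs_lt.1 (h₂ n ((le_max_right _ _).trans hn))
    have := hkey _ m hm n hn
    nlinarith [sq_nonneg ε]
  have hrep : ∀ n, ∃ c : ℕ →₀ ℝ, (∀ m, 0 ≤ c m) ∧ (∀ m ∈ c.support, n ≤ m) ∧
      ∑ m ∈ c.support, c m = 1 ∧ combo c u = z n := by
    intro n
    let G : Set (ℕ →₀ ℝ) := {c | (∀ m, 0 ≤ c m) ∧ (∀ m < n, c m = 0) ∧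
      Finsupp.linearCombination ℝ (fun _ => (1 : ℝ)) c = 1}
    have hG : Convex ℝ G := by
      rintro c ⟨h1, h2, h3⟩ d ⟨k1, k2, k3⟩ a b ha hb hab
      refine ⟨fun m => ?_, fun m hm => ?_, ?_⟩
      · simpa using add_nonneg (mul_nonneg ha (h1 m)) (mul_nonneg hb (k1 m))
      · simp [h2 m hm, k2 m hm]
      · rw [map_add, map_smul, map_smul, h3, k3]
        simpa using hab
    have himg : u '' Set.Ici n =
        Finsupp.linearCombination ℝ u '' ((fun m => Finsupp.single m (1 : ℝ)) '' Set.Ici n) := by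
      rw [Set.image_image]
      simp
    have hzn : z n ∈ Finsupp.linearCombination ℝ u ''
        convexHull ℝ ((fun m => Finsupp.single m (1 : ℝ)) '' Set.Ici n) := by
      rw [LinearMap.image_convexHull, ← himg]
      exact hzC n
    obtain ⟨c, hc, hcz⟩ := hzn
    have hcG : c ∈ G := by
      refine convexHull_min ?_ hG hc
      rintro _ ⟨m, hm, rfl⟩
      refine ⟨fun i => ?_, fun i hi => ?_, by simp⟩
      · simp only [Finsupp.single_apply]
        split_ifs <;> norm_num
      · exact Finsupp.single_eq_of_ne (hi.trans_le hm).ne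
    refine ⟨c, hcG.1, fun m hm => ?_, ?_, by rw [← hcz, Finsupp.linearCombination_apply]; rfl⟩
    · by_contra! h
      exact Finsupp.mem_support_iff.1 hm (hcG.2.1 m h)
    · simpa [Finsupp.linearCombination_apply, Finsupp.sum] using hcG.2.2
  choose c h1 h2 h3 h4 using hrep
  obtain ⟨x, hx⟩ := cauchySeq_tendsto_of_complete hcauchy
  exact ⟨c, ⟨h1, h2, h3⟩, x, by simpa only [h4] using hx⟩

end TailWeights

/-! ### Almost everywhere convergence of convex combinations of functions -/

section AEConvergence

variable {E : Type*} [NormedAddCommGroup E] [NormedSpace ℝ E]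

/-- On a separable set countably many functionals in the unit ball of the dual, one norming each
point of a countable dense subset, suffice to detect the zero vector. -/
theorem exists_seq_dual_separating {S : Set E} (hS : TopologicalSpace.IsSeparable S) :
    ∃ φ : ℕ → StrongDual ℝ E, (∀ i, ‖φ i‖ ≤ 1) ∧ ∀ x ∈ S, (∀ i, φ i x = 0) → x = 0 := by
  obtain ⟨D, hD, hSD⟩ := hS
  obtain ⟨d, hd⟩ := (hD.insert 0).exists_eq_range (Set.insert_nonempty _ _)
  choose φ hφ1 hφd using fun i => exists_dual_vector'' ℝ (d i)
  refine ⟨φ, hφ1, fun x hx h0 => ?_⟩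
  by_contra hne
  have hpos : 0 < ‖x‖ := norm_pos_iff.2 hne
  obtain ⟨y, hy, hxy⟩ := Metric.mem_closure_iff.1 (hSD hx) (‖x‖ / 2) (by positivity)
  obtain ⟨i, rfl⟩ : y ∈ Set.range d := hd ▸ Set.mem_insert_of_mem _ hy
  have h1 : ‖d i‖ ≤ ‖d i - x‖ := by
    have h := (φ i).le_opNorm (d i - x)
    rw [map_sub, h0 i, sub_zero, hφd i] at h
    simp only [RCLike.ofReal_real_eq_id, id_eq, norm_norm] at h
    exact h.trans (mul_le_of_le_one_left (norm_nonneg _) (hφ1 i))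
  rw [dist_comm, dist_eq_norm] at hxy
  have h2 : ‖x‖ ≤ ‖d i‖ + ‖d i - x‖ := by
    simpa [norm_sub_rev] using norm_le_norm_add_norm_sub' x (d i)
  linarith

variable [CompleteSpace E]

/-- Convex combinations of the tails of a totally bounded sequence stay in a compact set, so they
converge as soon as they converge against a separating family of functionals. -/
theorem exists_tendsto_combo {ι : Type*} {V : Submodule ℝ E} (hV : IsClosed (V : Set E))
    {φ : ι → StrongDual ℝ E} (hφ : ∀ x ∈ V, (∀ i, φ i x = 0) → x = 0) {v : ℕ → E}
    (hvV : ∀ m, v m ∈ V) (hv : TotallyBounded (Set.range v)) {c : ℕ → ℕ →₀ ℝ}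
    (hc : IsTailWeights c)
    (hlim : ∀ i, ∃ l, Tendsto (fun n => φ i (combo (c n) v)) atTop (𝓝 l)) :
    ∃ x, Tendsto (fun n => combo (c n) v) atTop (𝓝 x) := by
  let C := closure (convexHull ℝ (Set.range v))
  have hC : IsCompact C :=
    
    (totallyBounded_convexHull.2 hv).closure.isCompact_of_isClosed isClosed_closure
  have hCV : C ⊆ V := closure_minimal
    (convexHull_min (by rintro _ ⟨m, rfl⟩; exact hvV m) V.convex) hV
  have hmem : ∀ n, combo (c n) v ∈ C := fun n => subset_closure
    (hc.combo_mem (convex_convexHull ℝ _) n fun m _ => subset_convexHull ℝ _ ⟨m, rfl⟩)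
  obtain ⟨x, hxC, hx⟩ := hC.exists_mapClusterPt (f := atTop) (u := fun n => combo (c n) v)
    (tendsto_principal.2 (Eventually.of_forall hmem))
  refine ⟨x, hC.tendsto_nhds_of_unique_mapClusterPt (Eventually.of_forall hmem) ?_⟩
  intro y hyC hy
  choose l hl using hlim
  have key : ∀ z, MapClusterPt z atTop (fun n => combo (c n) v) → ∀ i, φ i z = l i :=
    fun z hz i => by
      have h : MapClusterPt (φ i z) atTop fun n => φ i (combo (c n) v) :=
        hz.continuousAt_comp (φ i).continuous.continuousAt
      exact eq_of_nhds_neBot (h.clusterPt.mono (hl i)).neBot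
  exact sub_eq_zero.1 (hφ (y - x) (V.sub_mem (hCV hyC) (hCV hxC)) fun i => by
    rw [map_sub, key y hy i, key x hx i, sub_self])

/-- If the values of a sequence of functions are relatively compact at almost every point, then
suitable convex combinations of its tails converge almost everywhere. Pairing with countably many
functionals and normalizing by the bound `g` places the sequence in an `L²` space, where the
Hilbert space argument supplies the coefficients; compactness lifts the convergence back to `E`. -/
theorem exists_ae_tendsto_combo {α : Type*} [MeasurableSpace α] {μ : Measure α}
    [IsFiniteMeasure μ] {w : ℕ → α → E} (hw : ∀ n, AEStronglyMeasurable (w n) μ) {g : α → ℝ}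
    (hg : AEMeasurable g μ) (hwg : ∀ᵐ s ∂μ, ∀ n, ‖w n s‖ ≤ g s)
    (htb : ∀ᵐ s ∂μ, TotallyBounded (Set.range fun n => w n s)) :
    ∃ c, IsTailWeights c ∧ ∃ z : α → E, AEStronglyMeasurable z μ ∧
      ∀ᵐ s ∂μ, Tendsto (fun n => combo (c n) fun m => w m s) atTop (𝓝 (z s)) := by
  let w' : ℕ → α → E := fun n => (hw n).mk
  have hw' : ∀ n, StronglyMeasurable (w' n) := fun n => (hw n).stronglyMeasurable_mk
  have hww' : ∀ᵐ s ∂μ, ∀ n, w n s = w' n s := ae_all_iff.2 fun n => (hw n).ae_eq_mk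
  let g' : α → ℝ := hg.mk
  have hg' : Measurable g' := hg.measurable_mk
  let V : Submodule ℝ E := (Submodule.span ℝ (⋃ n, Set.range (w' n))).topologicalClosure
  have hVsep : TopologicalSpace.IsSeparable (V : Set E) :=
    (TopologicalSpace.IsSeparable.span (R := ℝ)
      (.iUnion fun n => (hw' n).isSeparable_range)).closure
  have hwV : ∀ n s, w' n s ∈ V := fun n s => Submodule.le_topologicalClosure _
    (Submodule.subset_span (Set.mem_iUnion.2 ⟨n, s, rfl⟩))
  obtain ⟨φ, hφ1, hφ⟩ := exists_seq_dual_separating hVsep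
  -- A finite measure on `ℕ` that charges every point.
  let ν : Measure ℕ := Measure.count.toFinite
  have hν : ∀ P : ℕ → Prop, (∀ᵐ i ∂ν, P i) → ∀ i, P i := fun P hP => by
    have : ∀ᵐ i ∂(Measure.count : Measure ℕ), P i := by
      rwa [Filter.Eventually, ← ae_toFinite]
    exact Measure.ae_count_iff.1 this
  let f : ℕ → α × ℕ → ℝ := fun n p => (1 + |g' p.1|)⁻¹ * φ p.2 (w' n p.1)
  have hf : ∀ n, Measurable (f n) := fun n => measurable_from_prod_countable_left fun i =>
    ((measurable_const.add hg'.norm).inv).mul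
      ((φ i).continuous.comp_stronglyMeasurable (hw' n)).measurable
  have hf1 : ∀ n, ∀ᵐ p ∂μ.prod ν, ‖f n p‖ ≤ 1 := fun n => by
    have h : ∀ᵐ s ∂μ, ‖w' n s‖ ≤ g' s := by
      filter_upwards [hwg, hww', hg.ae_eq_mk] with s h1 h2 h3
      exact (h2 n ▸ h1 n).trans_eq h3
    filter_upwards [Measure.quasiMeasurePreserving_fst.ae h] with p hp
    have h1 : |φ p.2 (w' n p.1)| ≤ ‖w' n p.1‖ :=
      ((φ p.2).le_opNorm _).trans (mul_le_of_le_one_left (norm_nonneg _) (hφ1 _))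
    have h2 : 0 < 1 + |g' p.1| := by positivity
    simp only [f, norm_mul, norm_inv, Real.norm_eq_abs, abs_of_pos h2]
    rw [inv_mul_le_iff₀ h2]
    linarith [le_abs_self (g' p.1)]
  have hfLp : ∀ n, MemLp (f n) 2 (μ.prod ν) := fun n =>
    MemLp.of_bound (hf n).aestronglyMeasurable 1 (hf1 n)
  let U : ℕ → Lp ℝ 2 (μ.prod ν) := fun n => (hfLp n).toLp
  have hU : ∀ n, ‖U n‖ ≤ ((μ.prod ν) Set.univ ^ (2 : ℝ≥0∞).toReal⁻¹ * ENNReal.ofReal 1).toReal :=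
    fun n => by
      rw [Lp.norm_toLp]
      refine ENNReal.toReal_mono ?_ (eLpNorm_le_of_ae_bound (hf1 n))
      exact ENNReal.mul_ne_top (ENNReal.rpow_ne_top_of_nonneg (by positivity)
        (measure_ne_top _ _)) ENNReal.ofReal_ne_top
  obtain ⟨c, hc, X, hX⟩ := exists_isTailWeights_tendsto hU
  obtain ⟨ψ, hψ, hlim⟩ := (tendstoInMeasure_of_tendsto_Lp hX).exists_seq_tendsto_ae
  have hcombo : ∀ᵐ p ∂μ.prod ν, ∀ n, (combo (c n) U : Lp ℝ 2 (μ.prod ν)) p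
      = combo (c n) fun m => f m p := by
    refine ae_all_iff.2 fun n => ?_
    have h1 : ∀ᵐ p ∂μ.prod ν, ∀ m, (c n m • U m : Lp ℝ 2 (μ.prod ν)) p = c n m • f m p :=
      ae_all_iff.2 fun m => by
        filter_upwards [Lp.coeFn_smul (c n m) (U m), (hfLp m).coeFn_toLp] with p h1 h2
        rw [h1, Pi.smul_apply, h2]
    filter_upwards [Lp.coeFn_finsetSum (c n).support fun m => c n m • U m, h1] with p h2 h3
    simp only [combo]
    rw [h2]
    simp [h3]
  have hc' := hc.comp hψ
  refine ⟨_, hc', ?_⟩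
  have hconv : ∀ᵐ s ∂μ, ∃ x, Tendsto (fun n => combo (c (ψ n)) fun m => w m s) atTop (𝓝 x) := by
    have hprod : ∀ᵐ p ∂μ.prod ν,
        Tendsto (fun n => combo (c (ψ n)) fun m => f m p) atTop (𝓝 (X p)) := by
      filter_upwards [hlim, hcombo] with p h1 h2
      simpa only [h2] using h1
    filter_upwards [Measure.ae_ae_of_ae_prod hprod, hww', htb] with s h1 h2 h3
    simp only [h2] at h3 ⊢
    refine exists_tendsto_combo (Submodule.isClosed_topologicalClosure _) hφ (fun m => hwV m s) h3
      hc' fun i => ⟨(1 + |g' s|) * X (s, i), ?_⟩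
    have hpos : (1 + |g' s|) ≠ 0 := by positivity
    refine ((hν _ h1 i).const_mul (1 + |g' s|)).congr fun n => ?_
    simp only [combo, f, map_sum, map_smul, smul_eq_mul, Finset.mul_sum]
    refine Finset.sum_congr rfl fun m _ => ?_
    field_simp
  have hmeas : ∀ n, AEStronglyMeasurable (fun s => combo (c (ψ n)) fun m => w m s) μ := fun n =>
    Finset.aestronglyMeasurable_fun_sum _ fun m _ => (hw m).const_smul _
  obtain ⟨z, hz, hzlim⟩ := exists_stronglyMeasurable_limit_of_tendsto_ae hmeas hconv
  exact ⟨z, hz.aestronglyMeasurable, hzlim⟩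

end AEConvergence

/-! ### Noncompactness of a sequence of integrals -/

section NearestPoints

variable {E : Type*} [NormedAddCommGroup E]

/-- The distance of a sequence to the first `m` points of a dense sequence is eventually controlled
by its measure of noncompactness. The factor `2` arises from moving the centres of the balls, which
may lie off the separable set, to points of the dense sequence. -/
theorem eventually_edist_nearestPt_le [MeasurableSpace E] [OpensMeasurableSpace E] {e v : ℕ → E}
    (hv : ∀ n, v n ∈ closure (Set.range e)) {b : ℝ≥0∞}
    (hb : 2 * hausdorffMNC (Set.range v) < b) :
    ∀ᶠ m in atTop, ∀ n, edist (SimpleFunc.nearestPt e m (v n)) (v n) ≤ b := by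
  obtain ⟨r, hr, hrb⟩ : ∃ r, hausdorffMNC (Set.range v) < r ∧ 2 * r < b := by
    have h2 : hausdorffMNC (Set.range v) < b / 2 := by
      rw [ENNReal.lt_div_iff_mul_lt (by simp) (by simp), mul_comm]; exact hb
    obtain ⟨r, h, h'⟩ := exists_between h2
    rw [ENNReal.lt_div_iff_mul_lt (by simp) (by simp), mul_comm] at h'
    exact ⟨r, h, h'⟩
  obtain ⟨S, hS, hvS⟩ := exists_finite_cover_of_hausdorffMNC_lt hr
  have hj : ∀ c, ∃ j, ∀ n, edist (v n) c < r → edist (e j) (v n) ≤ b := by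
    intro c
    by_cases hc : ∃ n₀, edist (v n₀) c < r
    · obtain ⟨n₀, hn₀⟩ := hc
      obtain ⟨_, ⟨j, rfl⟩, hj⟩ := EMetric.mem_closure_iff.1 (hv n₀) (b - 2 * r)
        (tsub_pos_of_lt hrb)
      refine ⟨j, fun n hn => ?_⟩
      calc edist (e j) (v n) ≤ edist (e j) (v n₀) + edist (v n₀) c + edist c (v n) :=
            edist_triangle4 _ _ _ _
        _ ≤ (b - 2 * r) + r + r := by
            rw [edist_comm (e j), edist_comm c]
            gcongr
        _ = b := by rw [add_assoc, ← two_mul, tsub_add_cancel_of_le hrb.le]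
    · push Not at hc
      exact ⟨0, fun n hn => absurd hn (hc n).not_gt⟩
  choose j hj using hj
  obtain ⟨M, hM⟩ := (hS.image j).bddAbove
  filter_upwards [eventually_ge_atTop M] with m hm n
  obtain ⟨c, hc, hvc⟩ := hvS _ ⟨n, rfl⟩
  exact (SimpleFunc.edist_nearestPt_le e (v n) ((hM ⟨c, hc, rfl⟩).trans hm)).trans (hj c n hvc)

end NearestPoints

section IntegralMNC

variable {α E : Type*} [MeasurableSpace α] {μ : Measure α} [NormedAddCommGroup E] [NormedSpace ℝ E]
  [CompleteSpace E]

/-- The range of the vector measure with density `f` is relatively compact. -/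
theorem totallyBounded_setIntegral {f : α → E} (hf : Integrable f μ) :
    TotallyBounded {y | ∃ A, MeasurableSet A ∧ y = ∫ s in A, f s ∂μ} := by
  refine Integrable.induction
    (P := fun f => TotallyBounded {y | ∃ A, MeasurableSet A ∧ y = ∫ s in A, f s ∂μ})
    ?_ ?_ ?_ ?_ hf
  · intro c S hS hμS
    refine TotallyBounded.subset ?_
      ((isCompact_Icc (a := (0 : ℝ)) (b := μ.real S)).image
        (continuous_id.smul (continuous_const (y := c)))).totallyBounded
    rintro _ ⟨A, hA, rfl⟩
    refine ⟨μ.real (S ∩ A), ⟨measureReal_nonneg, ?_⟩, ?_⟩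
    · exact measureReal_mono Set.inter_subset_left hμS.ne
    · rw [integral_indicator hS, Measure.restrict_restrict hS, setIntegral_const]
      rfl
  · intro f g _ hf hg hPf hPg
    refine totallyBounded_of_subset_add hPf hPg ?_
    rintro _ ⟨A, hA, rfl⟩
    exact ⟨_, ⟨A, hA, rfl⟩, _, ⟨A, hA, rfl⟩, integral_add hf.integrableOn hg.integrableOn⟩
  · refine isClosed_iff_clusterPt.2 fun f hf => ?_
    rw [← mem_closure_iff_clusterPt] at hf
    change TotallyBounded _
    rw [← hausdorffMNC_eq_zero_iff, ← nonpos_iff_eq_zero]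
    refine le_of_forall_gt fun ε hε => ?_
    obtain ⟨ε', hε', hε''⟩ := exists_between hε
    obtain ⟨g, hg, hfg⟩ := EMetric.mem_closure_iff.1 hf ε' hε'
    refine lt_of_le_of_lt (hausdorffMNC_le_add (B := {0}) (r := ε') hg ?_) ?_
    · rintro _ ⟨A, hA, rfl⟩
      refine ⟨0, rfl, _, ⟨A, hA, rfl⟩, ?_⟩
      have hf1 := L1.integrable_coeFn f
      have hg1 := L1.integrable_coeFn g
      rw [zero_add, edist_eq_enorm_sub, ← integral_sub hf1.integrableOn hg1.integrableOn]
      refine (enorm_integral_le_lintegral_enorm _).trans ((setLIntegral_le_lintegral _ _).trans ?_)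
      rw [Lp.edist_def, eLpNorm_one_eq_lintegral_enorm] at hfg
      exact hfg.le
    · rwa [hausdorffMNC_eq_zero_iff.2 (Set.finite_singleton _).totallyBounded, zero_add]
  · intro f g hfg _ h
    convert h using 7 with y A
    exact integral_congr_ae (ae_restrict_of_ae hfg.symm)

theorem totallyBounded_sum_setIntegral {f : ℕ → α → E} (hf : ∀ j, Integrable (f j) μ)
    (t : Finset ℕ) :
    TotallyBounded {y | ∃ A : ℕ → Set α, (∀ j, MeasurableSet (A j)) ∧
      y = ∑ j ∈ t, ∫ s in A j, f j s ∂μ} := by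
  induction t using Finset.induction_on with
  | empty =>
    exact (Set.finite_singleton (0 : E)).totallyBounded.subset (by rintro _ ⟨A, _, rfl⟩; simp)
  | insert i t hi ih =>
    refine totallyBounded_of_subset_add (totallyBounded_setIntegral (hf i)) ih ?_
    rintro _ ⟨A, hA, rfl⟩
    exact ⟨_, ⟨A i, hA i, rfl⟩, _, ⟨A, hA, rfl⟩, Finset.sum_insert hi⟩

/-- A sequence of integrals `∫ K wₙ` whose integrands have values near `m + 1` fixed points differs
little from the totally bounded set of all `∑ⱼ ∫_{Aⱼ} K eⱼ`. -/
theorem hausdorffMNC_integral_le_lintegral_nearestPt [MeasurableSpace E] [BorelSpace E]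
    {K : α → E →L[ℝ] E} (hK : Integrable K μ)
    {w : ℕ → α → E} (hw : ∀ n, StronglyMeasurable (w n))
    (hKw : ∀ n, Integrable (fun s => K s (w n s)) μ) (e : ℕ → E) (m : ℕ) :
    hausdorffMNC (Set.range fun n => ∫ s, K s (w n s) ∂μ) ≤
      ∫⁻ s, ‖K s‖ₑ * ⨆ n, edist (SimpleFunc.nearestPt e m (w n s)) (w n s) ∂μ := by
  have hKe : ∀ j, Integrable (fun s => K s (e j)) μ := fun j => hK.apply_continuousLinearMap _
  have hzero : hausdorffMNC {(0 : E)} = 0 :=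
    hausdorffMNC_eq_zero_iff.2 (Set.finite_singleton _).totallyBounded
  refine (hausdorffMNC_le_add (B := {0})
    (totallyBounded_sum_setIntegral hKe (Finset.range (m + 1))) ?_).trans_eq
    (by rw [hzero, zero_add])
  rintro _ ⟨n, rfl⟩
  let A : ℕ → Set α := fun j => {s | SimpleFunc.nearestPtInd e m (w n s) = j}
  have hA : ∀ j, MeasurableSet (A j) := fun j =>
    (hw n).measurable ((SimpleFunc.nearestPtInd e m).measurableSet_fiber j)
  have hKv : ∀ s, K s (SimpleFunc.nearestPt e m (w n s)) =
      ∑ j ∈ Finset.range (m + 1), (A j).indicator (fun s => K s (e j)) s := by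
    intro s
    rw [Finset.sum_eq_single_of_mem (SimpleFunc.nearestPtInd e m (w n s))
      (Finset.mem_range.2 (Nat.lt_succ_of_le (SimpleFunc.nearestPtInd_le e m _)))]
    · rw [Set.indicator_of_mem (by rfl)]
      rfl
    · intro j _ hj
      exact Set.indicator_of_notMem (fun h => hj h.symm) _
  have hint : Integrable (fun s => K s (SimpleFunc.nearestPt e m (w n s))) μ := by
    simp only [hKv]
    exact integrable_finsetSum _ fun j _ => (hKe j).indicator (hA j)
  refine ⟨0, rfl, _, ⟨A, hA, rfl⟩, ?_⟩
  have hsum : ∑ j ∈ Finset.range (m + 1), ∫ s in A j, K s (e j) ∂μ =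
      ∫ s, K s (SimpleFunc.nearestPt e m (w n s)) ∂μ := by
    simp only [hKv]
    rw [integral_finsetSum _ fun j _ => (hKe j).indicator (hA j)]
    simp only [integral_indicator (hA _)]
  rw [hsum, zero_add, edist_eq_enorm_sub, ← integral_sub (hKw n) hint]
  refine (enorm_integral_le_lintegral_enorm _).trans (lintegral_mono fun s => ?_)
  rw [← map_sub]
  refine ((K s).le_opENorm _).trans (mul_le_mul_right ?_ _)
  rw [← edist_eq_enorm_sub, edist_comm]
  exact le_iSup (fun n => edist (SimpleFunc.nearestPt e m (w n s)) (w n s)) n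

theorem hausdorffMNC_integral_le_of_stronglyMeasurable {K : α → E →L[ℝ] E} (hK : Integrable K μ)
    (hKm : StronglyMeasurable K) {w : ℕ → α → E} (hw : ∀ n, StronglyMeasurable (w n))
    {g : α → ℝ≥0∞} (hwg : ∀ᵐ s ∂μ, ∀ n, ‖w n s‖ₑ ≤ g s) (hKg : ∫⁻ s, ‖K s‖ₑ * g s ∂μ ≠ ∞)
    {ρ : α → ℝ≥0∞} (hρ : ∀ᵐ s ∂μ, hausdorffMNC (Set.range fun n => w n s) ≤ ρ s) :
    hausdorffMNC (Set.range fun n => ∫ s, K s (w n s) ∂μ) ≤ ∫⁻ s, ‖K s‖ₑ * (2 * ρ s) ∂μ := by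
  borelize E
  obtain ⟨D, hD, hSD⟩ : TopologicalSpace.IsSeparable (⋃ n, Set.range (w n)) :=
    .iUnion fun n => (hw n).isSeparable_range
  obtain ⟨d, hd⟩ := (hD.insert 0).exists_eq_range (Set.insert_nonempty _ _)
  let e : ℕ → E := fun j => Nat.casesOn j 0 d
  have hwe : ∀ n s, w n s ∈ closure (Set.range e) := fun n s =>
    closure_mono (fun x hx => by
      obtain ⟨i, rfl⟩ : x ∈ Set.range d := hd ▸ Set.mem_insert_of_mem _ hx
      exact ⟨i + 1, rfl⟩) (hSD (Set.mem_iUnion.2 ⟨n, s, rfl⟩))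
  have hKw : ∀ n, Integrable (fun s => K s (w n s)) μ := fun n => by
    refine ⟨(ContinuousLinearMap.id ℝ (E →L[ℝ] E)).aestronglyMeasurable_comp₂
      hK.aestronglyMeasurable (hw n).aestronglyMeasurable, ?_⟩
    refine lt_of_le_of_lt (lintegral_mono_ae ?_) hKg.lt_top
    filter_upwards [hwg] with s hs
    exact ((K s).le_opENorm _).trans (mul_le_mul_right (hs n) _)
  let f : ℕ → α → ℝ≥0∞ := fun m s =>
    ‖K s‖ₑ * ⨆ n, edist (SimpleFunc.nearestPt e m (w n s)) (w n s)
  have hf : ∀ m, Measurable (f m) := fun m =>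
    hKm.enorm.mul (.iSup fun n => by
      simp only [edist_eq_enorm_sub]
      exact (((SimpleFunc.nearestPt e m).comp _ (hw n).measurable).stronglyMeasurable.sub
        (hw n)).enorm)
  -- Since `e 0 = 0`, the nearest points are at least as close as the origin.
  have hfg : ∀ m, f m ≤ᵐ[μ] fun s => ‖K s‖ₑ * g s := fun m => by
    filter_upwards [hwg] with s hs
    refine mul_le_mul_right (iSup_le fun n => ?_) _
    refine (SimpleFunc.edist_nearestPt_le e (w n s) (Nat.zero_le m)).trans ?_
    simpa [e, edist_comm] using hs n
  calc hausdorffMNC (Set.range fun n => ∫ s, K s (w n s) ∂μ)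
      ≤ limsup (fun m => ∫⁻ s, f m s ∂μ) atTop := le_limsup_of_frequently_le'
        (Frequently.of_forall fun m =>
          hausdorffMNC_integral_le_lintegral_nearestPt hK hw hKw e m)
    _ ≤ ∫⁻ s, limsup (fun m => f m s) atTop ∂μ := limsup_lintegral_le _ hf hfg hKg
    _ ≤ ∫⁻ s, ‖K s‖ₑ * (2 * ρ s) ∂μ := by
        refine lintegral_mono_ae ?_
        filter_upwards [hρ] with s hs
        refine (ENNReal.limsup_const_mul_of_ne_top enorm_ne_top).le.trans
          (mul_le_mul_right ?_ _)
        refine le_trans ?_ (mul_le_mul_right hs 2)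
        refine le_of_forall_gt_imp_ge_of_dense fun b hb => limsup_le_of_le (h := ?_)
        filter_upwards [eventually_edist_nearestPt_le (fun n => hwe n s) hb] with m hm
        exact iSup_le hm

/-- A Heinz type inequality: the measure of noncompactness of a sequence of integrals is at most
twice the integral of the pointwise measures of noncompactness, weighted with the norm of the
kernel. -/
theorem hausdorffMNC_integral_le {K : α → E →L[ℝ] E} (hK : Integrable K μ)
    {w : ℕ → α → E} (hw : ∀ n, AEStronglyMeasurable (w n) μ)
    {g : α → ℝ≥0∞} (hwg : ∀ᵐ s ∂μ, ∀ n, ‖w n s‖ₑ ≤ g s) (hKg : ∫⁻ s, ‖K s‖ₑ * g s ∂μ ≠ ∞)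
    {ρ : α → ℝ≥0∞} (hρ : ∀ᵐ s ∂μ, hausdorffMNC (Set.range fun n => w n s) ≤ ρ s) :
    hausdorffMNC (Set.range fun n => ∫ s, K s (w n s) ∂μ) ≤ ∫⁻ s, ‖K s‖ₑ * (2 * ρ s) ∂μ := by
  have hww : ∀ᵐ s ∂μ, ∀ n, w n s = (hw n).mk (w n) s := ae_all_iff.2 fun n => (hw n).ae_eq_mk
  have hKK := hK.aestronglyMeasurable.ae_eq_mk
  have h := hausdorffMNC_integral_le_of_stronglyMeasurable (hK.congr hKK)
    hK.aestronglyMeasurable.stronglyMeasurable_mk (fun n => (hw n).stronglyMeasurable_mk)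
    (g := g) (ρ := ρ) (by filter_upwards [hww, hwg] with s h1 h2 n using h1 n ▸ h2 n)
    (by
      refine (lintegral_congr_ae ?_).trans_ne hKg
      filter_upwards [hKK] with s hs
      rw [hs])
    (by filter_upwards [hww, hρ] with s h1 h2; simpa only [h1] using h2)
  have h1 : ∀ n, ∫ s, hK.aestronglyMeasurable.mk K s ((hw n).mk (w n) s) ∂μ
      = ∫ s, K s (w n s) ∂μ := fun n => integral_congr_ae (by
    filter_upwards [hww, hKK] with s h1 h2
    rw [h1, h2])
  simp only [h1] at h
  refine h.trans_eq (lintegral_congr_ae ?_)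
  filter_upwards [hKK] with s hs
  rw [hs]

end IntegralMNC

/-! ### The Volterra operator -/

section Kernel

variable {E : Type*} [NormedAddCommGroup E] [NormedSpace ℝ E] {T : ℝ} {p q : ℝ≥0∞}
  {k : Segment T → Segment T → E →L[ℝ] E}

instance (T : ℝ) : IsFiniteMeasure (volume : Measure (Segment T)) :=
  ⟨by
    rw [Measure.Subtype.volume_univ measurableSet_Icc.nullMeasurableSet]
    exact measure_Icc_lt_top⟩

theorem volume_segment_singleton (t : Segment T) : volume ({t} : Set (Segment T)) = 0 := by
  rw [Measure.Subtype.volume_def, Measure.comap_apply _ Subtype.val_injective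
    (fun s hs => measurableSet_Icc.subtype_image hs) _ (measurableSet_singleton t)]
  simp

theorem kernelSection_of_le {s t : Segment T} (h : s ≤ t) : kernelSection k t s = k t s :=
  Set.indicator_of_mem (s := Set.Iic t) h _

theorem kernelSection_of_lt {s t : Segment T} (h : t < s) : kernelSection k t s = 0 :=
  Set.indicator_of_notMem (s := Set.Iic t) h.not_ge _

theorem enorm_kernelSection_of_lt {s t : Segment T} (h : t < s) : ‖kernelSection k t s‖ₑ = 0 := by
  rw [kernelSection_of_lt h, ← ofReal_norm, norm_zero, ENNReal.ofReal_zero]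

theorem KernelHypotheses.memLp_kernelSection (hk : KernelHypotheses q k) (t : Segment T) :
    MemLp (kernelSection k t) q volume :=
  (memLp_indicator_iff_restrict (f := k t) (p := q) (μ := volume)
    (measurableSet_Iic (a := t))).2 (hk.memLp t)

theorem volterra_eq_integral (w : Segment T → E) (t : Segment T) :
    volterra k w t = ∫ s, kernelSection k t s (w s) := by
  rw [volterra, ← integral_indicator measurableSet_Iic]
  congr 1 with s
  by_cases h : s ≤ t
  · rw [kernelSection_of_le h, Set.indicator_of_mem (show s ∈ Set.Iic t from h)]
  · rw [kernelSection_of_lt (not_le.1 h), Set.indicator_of_notMem (show s ∉ Set.Iic t from h)]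
    rfl

theorem volterra_congr_of_ae_le {v w : Segment T → E} {t : Segment T}
    (h : ∀ᵐ s, s ≤ t → v s = w s) : volterra k v t = volterra k w t :=
  setIntegral_congr_ae measurableSet_Iic (h.mono fun s hs hst => by rw [hs hst])

/-- A Hölder estimate for the product of two norms. -/
theorem lintegral_enorm_mul_enorm_le [hpq : ENNReal.HolderConjugate q p] {G G' : Type*}
    [NormedAddCommGroup G] [NormedAddCommGroup G'] {α : Type*} [MeasurableSpace α] {μ : Measure α}
    {f : α → G} {g : α → G'} (hf : AEStronglyMeasurable f μ) (hg : AEStronglyMeasurable g μ) :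
    ∫⁻ s, ‖f s‖ₑ * ‖g s‖ₑ ∂μ ≤ eLpNorm f q μ * eLpNorm g p μ := by
  have h := eLpNorm_smul_le_mul_eLpNorm (p := q) (q := p) (r := 1) hg.norm hf.norm
  rw [eLpNorm_one_eq_lintegral_enorm, eLpNorm_norm, eLpNorm_norm] at h
  simpa [enorm_smul] using h

theorem KernelHypotheses.continuous_toLp (hk : KernelHypotheses q k) [Fact (1 ≤ q)] :
    Continuous fun t => (hk.memLp_kernelSection t).toLp := by
  refine continuous_iff_continuousAt.2 fun t => ?_
  rw [ContinuousAt, tendsto_iff_edist_tendsto_0]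
  simpa only [Lp.edist_toLp_toLp] using hk.continuous t

theorem KernelHypotheses.exists_eLpNorm_le (hk : KernelHypotheses q k) [Fact (1 ≤ q)] :
    ∃ K : ℝ≥0∞, K ≠ ∞ ∧ ∀ t, eLpNorm (kernelSection k t) q volume ≤ K := by
  obtain ⟨C, hC⟩ := (isCompact_range hk.continuous_toLp).isBounded.exists_norm_le
  refine ⟨ENNReal.ofReal C, ENNReal.ofReal_ne_top, fun t => ?_⟩
  have h := hC _ ⟨t, rfl⟩
  rw [Lp.norm_toLp] at h
  exact (ENNReal.le_ofReal_iff_toReal_le (hk.memLp_kernelSection t).2.ne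
    ((norm_nonneg _).trans (hC _ ⟨t, rfl⟩))).2 h

theorem KernelHypotheses.integrable_kernelSection [Fact (1 ≤ q)]
    (hk : KernelHypotheses q k) (t : Segment T) :
    Integrable (kernelSection k t) volume :=
  memLp_one_iff_integrable.1 ((hk.memLp_kernelSection t).mono_exponent Fact.out)

/-- By compactness of the segment, the kernel sections depend uniformly continuously on `t`. -/
theorem KernelHypotheses.exists_eLpNorm_sub_le (hk : KernelHypotheses q k) [Fact (1 ≤ q)]
    {ε : ℝ≥0∞} (hε : 0 < ε) : ∃ δ > 0, ∀ s t : Segment T, dist s t < δ →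
      eLpNorm (kernelSection k s - kernelSection k t) q volume ≤ ε := by
  have h := CompactSpace.uniformContinuous_of_continuous hk.continuous_toLp
  rw [EMetric.uniformContinuous_iff] at h
  obtain ⟨δ, hδ, h⟩ := h ε hε
  obtain ⟨δ', hδ', hδδ'⟩ := ENNReal.lt_iff_exists_nnreal_btwn.1 hδ
  refine ⟨δ', by exact_mod_cast hδ', fun s t hst => ?_⟩
  have := h (a := s) (b := t) (lt_of_le_of_lt ?_ hδδ')
  · rw [Lp.edist_toLp_toLp] at this
    exact this.le
  · rw [edist_nndist]
    exact_mod_cast hst.le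

theorem KernelHypotheses.exists_eLpNorm_sub_mul_le (hk : KernelHypotheses q k) [Fact (1 ≤ q)]
    {L ε : ℝ≥0∞} (hL : L ≠ ∞) (hε : 0 < ε) : ∃ δ > 0, ∀ s t : Segment T, dist s t < δ →
      eLpNorm (kernelSection k s - kernelSection k t) q volume * L ≤ ε := by
  obtain ⟨δ, hδ, h⟩ := hk.exists_eLpNorm_sub_le (ENNReal.div_pos hε.ne' hL)
  exact ⟨δ, hδ, fun s t hst => (mul_le_mul_left (h s t hst) L).trans
    ((mul_comm _ _).trans_le ENNReal.mul_div_le)⟩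

variable [ENNReal.HolderConjugate q p]

theorem KernelHypotheses.integrable_apply (hk : KernelHypotheses q k) {w : Segment T → E}
    (hw : MemLp w p volume) (t : Segment T) :
    Integrable (fun s => kernelSection k t s (w s)) volume := by
  have hkm := hk.memLp_kernelSection t
  refine ⟨(ContinuousLinearMap.id ℝ (E →L[ℝ] E)).aestronglyMeasurable_comp₂ hkm.1 hw.1, ?_⟩
  refine (lintegral_mono fun s => (kernelSection k t s).le_opENorm (w s)).trans_lt ?_
  exact (lintegral_enorm_mul_enorm_le (p := p) (q := q) hkm.1 hw.1).trans_lt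
    (ENNReal.mul_lt_top hkm.2 hw.2)

theorem KernelHypotheses.enorm_volterra_sub_le (hk : KernelHypotheses q k) {w : Segment T → E}
    (hw : MemLp w p volume) (s t : Segment T) :
    ‖volterra k w s - volterra k w t‖ₑ ≤
      eLpNorm (kernelSection k s - kernelSection k t) q volume * eLpNorm w p volume := by
  rw [volterra_eq_integral, volterra_eq_integral,
    ← integral_sub (hk.integrable_apply hw s) (hk.integrable_apply hw t)]
  refine (enorm_integral_le_lintegral_enorm _).trans (le_trans (lintegral_mono fun r => ?_)
    (lintegral_enorm_mul_enorm_le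
      ((hk.memLp_kernelSection s).sub (hk.memLp_kernelSection t)).1 hw.1))
  rw [← sub_apply]
  exact ContinuousLinearMap.le_opENorm _ _

theorem KernelHypotheses.continuous_volterra (hk : KernelHypotheses q k) [Fact (1 ≤ q)]
    {w : Segment T → E} (hw : MemLp w p volume) : Continuous (volterra k w) := by
  refine EMetric.continuous_iff.2 fun t ε hε => ?_
  obtain ⟨ε', hε', hεε'⟩ := exists_between hε
  obtain ⟨δ, hδ, h⟩ := hk.exists_eLpNorm_sub_mul_le hw.2.ne hε'
  refine ⟨ENNReal.ofReal δ, by simpa using hδ, fun s hs => ?_⟩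
  rw [edist_eq_enorm_sub]
  refine ((hk.enorm_volterra_sub_le hw s t).trans (h s t ?_)).trans_lt hεε'
  rwa [edist_dist, ENNReal.ofReal_lt_ofReal_iff hδ] at hs

theorem enorm_volterra_le {w : Segment T → E}
    (t : Segment T) :
    ‖volterra k w t‖ₑ ≤ ∫⁻ s, ‖kernelSection k t s‖ₑ * ‖w s‖ₑ := by
  rw [volterra_eq_integral]
  exact (enorm_integral_le_lintegral_enorm _).trans
    (lintegral_mono fun s => ContinuousLinearMap.le_opENorm _ _)

/-! ### A Gronwall inequality for Volterra kernels -/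

/-- The Gronwall inequality on the part of the segment up to time `n δ`, by induction on `n`. On the
next interval of length `δ` the kernel section at `t` differs little from the one at `t - δ`, which
vanishes beyond `t - δ`; the new contribution is therefore at most half of the supremum sought. -/
theorem exists_gronwall_const_step {b : Segment T → ℝ} (hb : AEStronglyMeasurable b volume)
    (hk : KernelHypotheses q k) {K : ℝ≥0∞} (hK : K ≠ ∞)
    (hkK : ∀ t, eLpNorm (kernelSection k t) q volume * eLpNorm b p volume ≤ K)
    {δ : ℝ} (hδ : 0 < δ) (hkδ : ∀ s t : Segment T, dist s t ≤ δ →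
      eLpNorm (kernelSection k s - kernelSection k t) q volume * eLpNorm b p volume ≤ 1 / 2)
    (n : ℕ) :
    ∃ C : ℝ≥0∞, C ≠ ∞ ∧ ∀ (A : ℝ≥0∞) (u : Segment T → ℝ≥0∞), ⨆ t, u t ≠ ∞ →
      (∀ t, u t ≤ A + ∫⁻ s, ‖kernelSection k t s‖ₑ * (‖b s‖ₑ * ⨆ s' ≤ s, u s')) →
      ∀ t : Segment T, (t : ℝ) ≤ n * δ → u t ≤ C * A := by
  induction n with
  | zero =>
    refine ⟨1, ENNReal.one_ne_top, fun A u _ hu t ht => ?_⟩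
    have ht0 : (t : ℝ) = 0 := le_antisymm (by simpa using ht) t.2.1
    have h0 : ∀ᵐ s, ‖kernelSection k t s‖ₑ * (‖b s‖ₑ * ⨆ s' ≤ s, u s') = 0 := by
      filter_upwards [compl_mem_ae_iff.2 (volume_segment_singleton t)] with s hs
      have hts : t < s := lt_of_le_of_ne (Subtype.coe_le_coe.1 (ht0.trans_le s.2.1)) (Ne.symm hs)
      rw [enorm_kernelSection_of_lt hts, zero_mul]
    have := hu t
    rwa [lintegral_congr_ae h0, lintegral_zero, add_zero, ← one_mul A] at this
  | succ n ih =>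
    obtain ⟨C, hC, ih⟩ := ih
    refine ⟨2 * (1 + K * C), by finiteness, fun A u hbdd hu t ht => ?_⟩
    let M : ℝ≥0∞ := ⨆ (t : Segment T) (_ : (t : ℝ) ≤ (n + 1 : ℕ) * δ), u t
    have hM : M ≠ ∞ := ne_top_of_le_ne_top hbdd (iSup₂_le fun t _ => le_iSup u t)
    have key : M ≤ (A + K * (C * A)) + M / 2 := by
      refine iSup₂_le fun t ht => ?_
      let t₀ : Segment T := ⟨max 0 (t - δ), le_max_left _ _,
        max_le (t.2.1.trans t.2.2) (by linarith [t.2.2])⟩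
      have ht₀t : dist t t₀ ≤ δ := by
        rw [Subtype.dist_eq, Real.dist_eq, abs_le]
        have := t.2.1
        constructor
        · rcases max_cases 0 ((t : ℝ) - δ) with h | h <;> simp only [t₀, h.1] <;> linarith
        · have := le_max_right 0 ((t : ℝ) - δ)
          simp only [t₀]
          linarith
      have ht₀n : (t₀ : ℝ) ≤ n * δ := by
        push_cast at ht
        exact max_le (by positivity) (by linarith)
      have hpt : ∀ s, ‖kernelSection k t s‖ₑ * (‖b s‖ₑ * ⨆ s' ≤ s, u s') ≤
          ‖kernelSection k t s‖ₑ * ‖b s‖ₑ * (C * A) +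
            ‖(kernelSection k t - kernelSection k t₀) s‖ₑ * ‖b s‖ₑ * M := by
        intro s
        rcases le_or_gt s t₀ with h | h
        · refine le_trans ?_ le_self_add
          rw [← mul_assoc]
          gcongr
          exact iSup₂_le fun s' hs' => ih A u hbdd hu s'
            ((Subtype.coe_le_coe.2 (hs'.trans h)).trans ht₀n)
        · rcases le_or_gt s t with h' | h'
          · refine le_trans ?_ le_add_self
            rw [Pi.sub_apply, kernelSection_of_lt h, sub_zero, ← mul_assoc]
            gcongr
            exact iSup₂_le fun s' hs' => le_iSup₂_of_le s'
              ((Subtype.coe_le_coe.2 (hs'.trans h')).trans ht) le_rfl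
          · rw [enorm_kernelSection_of_lt h', zero_mul]
            exact zero_le
      have hkm : ∀ t, AEStronglyMeasurable (kernelSection k t) volume :=
        fun t => (hk.memLp_kernelSection t).1
      calc u t ≤ A + ∫⁻ s, ‖kernelSection k t s‖ₑ * (‖b s‖ₑ * ⨆ s' ≤ s, u s') := hu t
        _ ≤ A + ∫⁻ s, (‖kernelSection k t s‖ₑ * ‖b s‖ₑ * (C * A) +
            ‖(kernelSection k t - kernelSection k t₀) s‖ₑ * ‖b s‖ₑ * M) := by
          gcongr with s
          exact hpt s
        _ = A + ((∫⁻ s, ‖kernelSection k t s‖ₑ * ‖b s‖ₑ) * (C * A) +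
            (∫⁻ s, ‖(kernelSection k t - kernelSection k t₀) s‖ₑ * ‖b s‖ₑ) * M) := by
          have h1 : AEMeasurable (fun s => ‖kernelSection k t s‖ₑ * ‖b s‖ₑ) volume :=
            (hkm t).enorm.mul hb.enorm
          have h2 : AEMeasurable
              (fun s => ‖(kernelSection k t - kernelSection k t₀) s‖ₑ * ‖b s‖ₑ) volume :=
            ((hkm t).sub (hkm t₀)).enorm.mul hb.enorm
          rw [lintegral_add_left' (h1.mul_const _), lintegral_mul_const'' _ h1,
            lintegral_mul_const'' _ h2]
        _ ≤ A + (K * (C * A) + 1 / 2 * M) := by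
          gcongr
          · exact (lintegral_enorm_mul_enorm_le (hkm t) hb).trans (hkK t)
          · exact (lintegral_enorm_mul_enorm_le ((hkm t).sub (hkm t₀)) hb).trans
              (hkδ t t₀ ht₀t)
        _ = (A + K * (C * A)) + M / 2 := by
          rw [add_assoc, ENNReal.div_eq_inv_mul (a := M), one_div]
    have hhalf : M / 2 ≤ A + K * (C * A) := by
      refine ENNReal.le_of_add_le_add_right (ENNReal.div_ne_top hM two_ne_zero) ?_
      rwa [ENNReal.add_halves M]
    calc u t ≤ M := le_iSup₂_of_le t ht le_rfl
      _ = 2 * (M / 2) := (ENNReal.mul_div_cancel two_ne_zero ENNReal.ofNat_ne_top).symm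
      _ ≤ 2 * (A + K * (C * A)) := by gcongr
      _ = 2 * (1 + K * C) * A := by ring

/-- **Gronwall inequality** for the kernel `‖k(t, s)‖ |b(s)|`, with past suprema in place of values
so that it also covers delayed arguments. Since the bound is linear in `A`, the case `A = 0` forces
`u = 0`. No measurability of `u` is needed. -/
theorem KernelHypotheses.exists_gronwall_const (hk : KernelHypotheses q k) [Fact (1 ≤ q)]
    {b : Segment T → ℝ} (hb : MemLp b p volume) :
    ∃ C : ℝ≥0∞, C ≠ ∞ ∧ ∀ (A : ℝ≥0∞) (u : Segment T → ℝ≥0∞), ⨆ t, u t ≠ ∞ →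
      (∀ t, u t ≤ A + ∫⁻ s, ‖kernelSection k t s‖ₑ * (‖b s‖ₑ * ⨆ s' ≤ s, u s')) →
      ∀ t, u t ≤ C * A := by
  obtain ⟨K, hK, hkK⟩ := hk.exists_eLpNorm_le
  obtain ⟨δ, hδ, hkδ⟩ := hk.exists_eLpNorm_sub_mul_le hb.2.ne (ε := 1 / 2) (by simp)
  obtain ⟨n, hn⟩ := exists_nat_ge (T / (δ / 2))
  obtain ⟨C, hC, h⟩ := exists_gronwall_const_step hb.1 hk
    (ENNReal.mul_ne_top hK hb.2.ne) (fun t => mul_le_mul_left (hkK t) _) (half_pos hδ)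
    (fun s t hst => hkδ s t (hst.trans_lt (half_lt_self hδ))) n
  exact ⟨C, hC, fun A u hbdd hu t =>
    h A u hbdd hu t (t.2.2.trans ((div_le_iff₀ (half_pos hδ)).1 hn))⟩

end Kernel

/-! ### Compactness of families of approximate solutions -/

section Compactness

theorem uniformEquicontinuous_of_tendsto {E : Type*} [NormedAddCommGroup E]
    {X : Type*} [UniformSpace X] [CompactSpace X]
    {h : ℕ → C(X, E)} {h₀ : C(X, E)} (hh : Tendsto h atTop (𝓝 h₀)) :
    UniformEquicontinuous fun n t => h n t := by
  rw [Metric.uniformEquicontinuous_iff_right]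
  intro ε hε
  obtain ⟨N, hN⟩ := Metric.tendsto_atTop.1 hh (ε / 3) (by positivity)
  have hu : ∀ f : C(X, E), ∀ᶠ st in uniformity X, dist (f st.1) (f st.2) < ε / 3 := fun f =>
    (CompactSpace.uniformContinuous_of_continuous f.continuous)
      (Metric.dist_mem_uniformity (by positivity))
  filter_upwards [hu h₀, (Set.finite_lt_nat N).eventually_all.2 fun n _ => hu (h n)] with st h1 h2 n
  rcases lt_or_ge n N with hn | hn
  · exact (h2 n hn).trans (by linarith)
  · have h3 := fun t => (ContinuousMap.dist_apply_le_dist t).trans_lt (hN n hn)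
    have h4 := dist_triangle4 (h n st.1) (h₀ st.1) (h₀ st.2) (h n st.2)
    have h5 := h3 st.1
    have h6 := h3 st.2
    rw [dist_comm] at h6
    linarith

variable {E : Type*} [NormedAddCommGroup E] [NormedSpace ℝ E]

/-- Upper hemicontinuity passes to limits of convex combinations: if the limit lay off the closed
convex set `G x`, a functional would strictly separate it from `G x`, hence from the values of `G`
near `x`. -/
theorem IsUpperHemicontinuous.mem_of_tendsto_combo {G : E → Set E} (hG : IsUpperHemicontinuous G)
    {x : E} (hconv : Convex ℝ (G x)) (hclosed : IsClosed (G x)) {y v : ℕ → E}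
    (hy : Tendsto y atTop (𝓝 x)) (hv : ∀ n, v n ∈ G (y n)) {c : ℕ → ℕ →₀ ℝ}
    (hc : IsTailWeights c) {z : E} (hz : Tendsto (fun n => combo (c n) v) atTop (𝓝 z)) :
    z ∈ G x := by
  by_contra hzG
  obtain ⟨φ, r, hr, hrz⟩ := geometric_hahn_banach_closed_point hconv hclosed hzG
  obtain ⟨r', hrr', hr'z⟩ := exists_between hrz
  have hsup : supportFun φ (G x) < (r' : EReal) :=
    (iSup₂_le fun a ha => EReal.coe_le_coe_iff.2 (hr a ha).le).trans_lt
      (EReal.coe_lt_coe_iff.2 hrr')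
  have hev : ∀ᶠ n in atTop, supportFun φ (G (y n)) < (r' : EReal) := hy.eventually (hG φ x _ hsup)
  obtain ⟨N, hN⟩ := eventually_atTop.1 hev
  have hle : ∀ n ≥ N, φ (v n) ≤ r' := fun n hn => EReal.coe_le_coe_iff.1
    ((le_iSup₂ (f := fun a (_ : a ∈ G (y n)) => ((φ a : ℝ) : EReal)) (v n) (hv n)).trans
      (hN n hn).le)
  have hφz : φ z ≤ r' := by
    refine le_of_tendsto ((φ.continuous.tendsto z).comp hz) ?_
    filter_upwards [eventually_ge_atTop N] with n hn
    have h := hc.combo_mem (convex_Iic r') n (u := fun m => φ (v m)) fun m hm => hle m (hn.trans hm)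
    exact (map_combo (φ : E →ₗ[ℝ] ℝ) (c n) v).trans_le h
  exact hr'z.not_ge hφz

variable {T : ℝ} {p q : ℝ≥0∞} {F : Segment T → E → Set E}
  {k : Segment T → Segment T → E →L[ℝ] E}

/-- A sequence of approximate solutions of the integral inclusion: `x n = h n + V (w n)`, where
`w n` selects from the values of `F` along `x n` evaluated at delayed times `θ n t ≤ t`, and the
delays tend to zero uniformly. -/
structure IsApproxSolution (p : ℝ≥0∞) (F : Segment T → E → Set E)
    (k : Segment T → Segment T → E →L[ℝ] E) (θ : ℕ → Segment T → Segment T)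
    (h x : ℕ → C(Segment T, E)) (w : ℕ → Segment T → E) : Prop where
  memLp : ∀ n, MemLp (w n) p volume
  eq_add : ∀ n t, x n t = h n t + volterra k (w n) t
  delay_le : ∀ n t, θ n t ≤ t
  delay_tendsto : ∃ δ : ℕ → ℝ, Tendsto δ atTop (𝓝 0) ∧ ∀ n t, dist (θ n t) t ≤ δ n
  mem : ∀ n, ∀ᵐ t, w n t ∈ F t (x n (θ n t))

namespace IsApproxSolution

variable {θ : ℕ → Segment T → Segment T} {h x : ℕ → C(Segment T, E)} {w : ℕ → Segment T → E}
  {h₀ : C(Segment T, E)}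

theorem comp (hx : IsApproxSolution p F k θ h x w) {ψ : ℕ → ℕ} (hψ : StrictMono ψ) :
    IsApproxSolution p F k (θ ∘ ψ) (h ∘ ψ) (x ∘ ψ) (w ∘ ψ) where
  memLp n := hx.memLp (ψ n)
  eq_add n := hx.eq_add (ψ n)
  delay_le n := hx.delay_le (ψ n)
  delay_tendsto := by
    obtain ⟨δ, hδ, h⟩ := hx.delay_tendsto
    exact ⟨δ ∘ ψ, hδ.comp hψ.tendsto_atTop, fun n => h (ψ n)⟩
  mem n := hx.mem (ψ n)

variable [ENNReal.HolderConjugate q p] [Fact (1 ≤ q)]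

/-- The linear growth of `F` and the Gronwall inequality bound approximate solutions. -/
theorem exists_norm_le (hx : IsApproxSolution p F k θ h x w) (hF : MultimapHypotheses p F)
    (hk : KernelHypotheses q k) (hh : Tendsto h atTop (𝓝 h₀)) : ∃ R : ℝ≥0, ∀ n t, ‖x n t‖ ≤ R := by
  obtain ⟨c, hc, hgrowth⟩ := hF.growth
  obtain ⟨C, hC, hgron⟩ := hk.exists_gronwall_const hc
  obtain ⟨H, hH⟩ := (Metric.isBounded_range_of_tendsto h hh).exists_norm_le
  have hHn : ∀ n t, ‖h n t‖ₑ ≤ ENNReal.ofReal H := fun n t => by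
    rw [← ofReal_norm]
    exact ENNReal.ofReal_le_ofReal (((h n).norm_coe_le_norm t).trans (hH _ ⟨n, rfl⟩))
  have hbound : ∀ n t, 1 + ‖x n t‖ₑ ≤ C * (1 + ENNReal.ofReal H) := by
    intro n
    refine hgron _ _ ?_ fun t => ?_
    · refine ne_top_of_le_ne_top (b := 1 + ENNReal.ofReal ‖x n‖) (by finiteness)
        (iSup_le fun t => ?_)
      rw [← ofReal_norm]
      gcongr
      exact (x n).norm_coe_le_norm t
    · have hw : ∀ᵐ s, ‖w n s‖ₑ ≤ ‖c s‖ₑ * ⨆ s' ≤ s, (1 + ‖x n s'‖ₑ) := by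
        filter_upwards [hgrowth, hx.mem n] with s hs hws
        have h1 := hs _ _ hws
        calc ‖w n s‖ₑ = ENNReal.ofReal ‖w n s‖ := (ofReal_norm _).symm
          _ ≤ ENNReal.ofReal (‖c s‖ * (1 + ‖x n (θ n s)‖)) := by
            gcongr
            exact h1.trans (by gcongr; exact Real.le_norm_self _)
          _ = ‖c s‖ₑ * (1 + ‖x n (θ n s)‖ₑ) := by
            rw [ENNReal.ofReal_mul (norm_nonneg _), ENNReal.ofReal_add zero_le_one (norm_nonneg _),
              ofReal_norm, ofReal_norm, ENNReal.ofReal_one]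
          _ ≤ ‖c s‖ₑ * ⨆ s' ≤ s, (1 + ‖x n s'‖ₑ) := by
            gcongr
            exact le_iSup₂ (f := fun s' (_ : s' ≤ s) => 1 + ‖x n s'‖ₑ) _ (hx.delay_le n s)
      calc 1 + ‖x n t‖ₑ ≤ 1 + (‖h n t‖ₑ + ‖volterra k (w n) t‖ₑ) := by
            rw [hx.eq_add n t]
            gcongr
            exact enorm_add_le _ _
        _ ≤ 1 + (ENNReal.ofReal H + ∫⁻ s, ‖kernelSection k t s‖ₑ * ‖w n s‖ₑ) := by
            gcongr
            · exact hHn n t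
            · exact enorm_volterra_le t
        _ ≤ 1 + (ENNReal.ofReal H + ∫⁻ s, ‖kernelSection k t s‖ₑ *
            (‖c s‖ₑ * ⨆ s' ≤ s, (1 + ‖x n s'‖ₑ))) := by
            gcongr 1 + (_ + ?_)
            exact lintegral_mono_ae (hw.mono fun s hs => mul_le_mul_right hs _)
        _ = _ := (add_assoc _ _ _).symm
  refine ⟨(C * (1 + ENNReal.ofReal H)).toNNReal, fun n t => ?_⟩
  have h1 : ‖x n t‖ₑ ≤ C * (1 + ENNReal.ofReal H) := le_add_self.trans (hbound n t)
  rw [← ENNReal.coe_toNNReal (show C * (1 + ENNReal.ofReal H) ≠ ∞ by finiteness)] at h1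
  exact_mod_cast h1

theorem exists_dominating (hx : IsApproxSolution p F k θ h x w) (hF : MultimapHypotheses p F)
    (hk : KernelHypotheses q k) (hh : Tendsto h atTop (𝓝 h₀)) :
    ∃ g : Segment T → ℝ, MemLp g p volume ∧ ∀ᵐ s, ∀ n, ‖w n s‖ ≤ g s := by
  obtain ⟨R, hR⟩ := hx.exists_norm_le hF hk hh
  obtain ⟨c, hc, hgrowth⟩ := hF.growth
  refine ⟨fun s => ‖c s‖ * (1 + R), hc.norm.mul_const _, ?_⟩
  filter_upwards [hgrowth, ae_all_iff.2 hx.mem] with s hs hws n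
  refine (hs _ _ (hws n)).trans ?_
  gcongr
  · exact Real.le_norm_self _
  · exact hR _ _

theorem uniformEquicontinuous (hx : IsApproxSolution p F k θ h x w) (hF : MultimapHypotheses p F)
    (hk : KernelHypotheses q k) (hh : Tendsto h atTop (𝓝 h₀)) :
    UniformEquicontinuous fun n t => x n t := by
  obtain ⟨g, hg, hwg⟩ := hx.exists_dominating hF hk hh
  rw [Metric.uniformEquicontinuous_iff]
  intro ε hε
  obtain ⟨δ₁, hδ₁, h₁⟩ := Metric.uniformEquicontinuous_iff.1 (uniformEquicontinuous_of_tendsto hh)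
    (ε / 2) (half_pos hε)
  obtain ⟨δ₂, hδ₂, h₂⟩ := hk.exists_eLpNorm_sub_mul_le hg.2.ne
    (ε := ENNReal.ofReal (ε / 2)) (by simpa using hε)
  refine ⟨min δ₁ δ₂, lt_min hδ₁ hδ₂, fun s t hst n => ?_⟩
  have hV : ‖volterra k (w n) s - volterra k (w n) t‖ ≤ ε / 2 := by
    have h3 : eLpNorm (w n) p volume ≤ eLpNorm g p volume :=
      eLpNorm_mono_ae_real (hwg.mono fun s hs => hs n)
    have h4 := (hk.enorm_volterra_sub_le (hx.memLp n) s t).trans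
      ((mul_le_mul_right h3 _).trans (h₂ s t (hst.trans_le (min_le_right _ _))))
    rwa [← ofReal_norm, ENNReal.ofReal_le_ofReal_iff (half_pos hε).le] at h4
  rw [hx.eq_add n s, hx.eq_add n t]
  refine (dist_add_add_le _ _ _ _).trans_lt ?_
  rw [dist_eq_norm (volterra k (w n) s)]
  linarith [h₁ s t (hst.trans_le (min_le_left _ _)) n]

/-- Pointwise noncompactness of the selections is controlled by that of the approximate solutions.
The exceptional null set in the compactness hypothesis on `F` depends on the set `Ω`, so it is only
applied to countably many sets: the pieces of the trajectories over finite covers of the segment by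
small balls, on which equicontinuity makes the trajectories almost constant. -/
theorem ae_hausdorffMNC_le (hx : IsApproxSolution p F k θ h x w) (hF : MultimapHypotheses p F)
    (hk : KernelHypotheses q k) (hh : Tendsto h atTop (𝓝 h₀)) {η : Segment T → ℝ}
    (hη : ∀ Ω : Set E, Bornology.IsBounded Ω →
      ∀ᵐ t, hausdorffMNC (⋃ x ∈ Ω, F t x) ≤ ENNReal.ofReal (η t) * hausdorffMNC Ω) :
    ∀ᵐ t, hausdorffMNC (Set.range fun n => w n t) ≤
      ENNReal.ofReal (η t) * hausdorffMNC (Set.range fun n => x n t) := by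
  obtain ⟨R, hR⟩ := hx.exists_norm_le hF hk hh
  have heq := Metric.uniformEquicontinuous_iff.1 (hx.uniformEquicontinuous hF hk hh)
  obtain ⟨d, hd, hθd⟩ := hx.delay_tendsto
  have hε : ∀ ε : ℝ, 0 < ε → ∀ᵐ t, hausdorffMNC (Set.range fun n => w n t) ≤ ENNReal.ofReal (η t) *
      (hausdorffMNC (Set.range fun n => x n t) + (ENNReal.ofReal ε + ENNReal.ofReal ε)) := by
    intro ε hε
    obtain ⟨δ, hδ, hxδ⟩ := heq ε hε
    obtain ⟨N, hN⟩ := eventually_atTop.1 (hd.eventually (gt_mem_nhds hδ))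
    obtain ⟨D, -, hDfin, hD⟩ := finite_cover_balls_of_compact
      (isCompact_univ (X := Segment T)) (half_pos hδ)
    let Ω : Segment T → Set E := fun a =>
      {y | ∃ n ≥ N, ∃ t ∈ Metric.ball a (δ / 2), y = x n (θ n t)}
    have hΩ : ∀ a, Bornology.IsBounded (Ω a) := fun a =>
      isBounded_iff_forall_norm_le.2 ⟨R, by rintro _ ⟨n, _, t, _, rfl⟩; exact hR _ _⟩
    filter_upwards [ae_all_iff.2 hx.mem,
      (ae_ball_iff hDfin.countable).2 fun a _ => hη (Ω a) (hΩ a)] with t hwt hηt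
    obtain ⟨a, haD, hta⟩ := Set.mem_iUnion₂.1 (hD (Set.mem_univ t))
    calc hausdorffMNC (Set.range fun n => w n t) ≤ hausdorffMNC (⋃ y ∈ Ω a, F t y) :=
          hausdorffMNC_range_le_of_tail (N := N) fun n hn =>
            Set.mem_biUnion (⟨n, hn, t, hta, rfl⟩ : x n (θ n t) ∈ Ω a) (hwt n)
      _ ≤ ENNReal.ofReal (η t) * hausdorffMNC (Ω a) := hηt a haD
      _ ≤ _ := by
        gcongr
        refine hausdorffMNC_le_add (P := {0}) (Set.finite_singleton _).totallyBounded ?_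
        rintro _ ⟨n, hn, t', ht', rfl⟩
        refine ⟨_, ⟨n, rfl⟩, 0, rfl, ?_⟩
        rw [add_zero]
        refine (edist_triangle _ (x n t') _).trans (add_le_add ?_ ?_)
        · rw [edist_dist]
          exact ENNReal.ofReal_le_ofReal (hxδ _ _ ((hθd n t').trans_lt (hN n hn)) n).le
        · rw [edist_dist]
          refine ENNReal.ofReal_le_ofReal (hxδ _ _ ?_ n).le
          calc dist t' t ≤ dist t' a + dist t a := dist_triangle_right _ _ _
            _ < δ / 2 + δ / 2 := add_lt_add ht' hta
            _ = δ := add_halves δ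
  have hall : ∀ᵐ t, ∀ j : ℕ, _ := ae_all_iff.2 fun j : ℕ =>
    hε (1 / ((j : ℝ) + 1)) Nat.one_div_pos_of_nat
  filter_upwards [hall] with t ht
  have h0 : Tendsto (fun j : ℕ => ENNReal.ofReal (1 / ((j : ℝ) + 1))) atTop (𝓝 0) := by
    simpa using ENNReal.tendsto_ofReal tendsto_one_div_add_atTop_nhds_zero_nat
  have hlim := ENNReal.Tendsto.const_mul (a := ENNReal.ofReal (η t))
    ((tendsto_const_nhds (x := hausdorffMNC (Set.range fun n => x n t))).add (h0.add h0))
    (Or.inr ENNReal.ofReal_ne_top)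
  rw [add_zero, add_zero] at hlim
  exact ge_of_tendsto' hlim ht

variable [CompleteSpace E]

/-- The measure of noncompactness of the values of the approximate solutions satisfies a homogeneous
Gronwall inequality, hence vanishes. -/
theorem totallyBounded_range_apply (hx : IsApproxSolution p F k θ h x w)
    (hF : MultimapHypotheses p F) (hk : KernelHypotheses q k) (hh : Tendsto h atTop (𝓝 h₀))
    (t : Segment T) : TotallyBounded (Set.range fun n => x n t) := by
  obtain ⟨R, hR⟩ := hx.exists_norm_le hF hk hh
  obtain ⟨g, hg, hwg⟩ := hx.exists_dominating hF hk hh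
  obtain ⟨η, hηp, hη⟩ := hF.compactness
  obtain ⟨C, -, hgron⟩ := hk.exists_gronwall_const (hηp.const_mul 2)
  have h0 := hgron 0 (fun t => hausdorffMNC (Set.range fun n => x n t)) ?_ ?_ t
  · rw [mul_zero, nonpos_iff_eq_zero] at h0
    exact hausdorffMNC_eq_zero_iff.1 h0
  · refine ne_top_of_le_ne_top (b := (R : ℝ≥0∞)) ENNReal.coe_ne_top (iSup_le fun t => ?_)
    refine hausdorffMNC_le_of_forall_norm_le ?_
    rintro _ ⟨n, rfl⟩
    rw [← ofReal_norm, ENNReal.ofReal_le_iff_le_toReal ENNReal.coe_ne_top]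
    exact hR n t
  · intro t
    have hht : TotallyBounded (Set.range fun n => h n t) :=
      (((ContinuousEvalConst.continuous_eval_const (F := C(Segment T, E)) t).tendsto h₀).comp
        hh).isCompact_insert_range.totallyBounded.subset (Set.subset_insert _ _)
    have h1 : hausdorffMNC (Set.range fun n => x n t) ≤
        hausdorffMNC (Set.range fun n => ∫ s, kernelSection k t s (w n s)) + 0 := by
      refine hausdorffMNC_le_add hht ?_
      rintro _ ⟨n, rfl⟩
      refine ⟨_, ⟨n, rfl⟩, _, ⟨n, rfl⟩, ?_⟩
      simp only [hx.eq_add n t, volterra_eq_integral]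
      rw [add_comm, edist_self]
    have h2 := hausdorffMNC_integral_le (hk.integrable_kernelSection t) (fun n => (hx.memLp n).1)
      (g := fun s => ‖g s‖ₑ) (hwg.mono fun s hs n => ?_)
      (ne_top_of_le_ne_top (ENNReal.mul_ne_top (hk.memLp_kernelSection t).2.ne hg.2.ne)
        (lintegral_enorm_mul_enorm_le (hk.memLp_kernelSection t).1 hg.1))
      (hx.ae_hausdorffMNC_le hF hk hh hη)
    · rw [zero_add]
      refine (h1.trans_eq (add_zero _)).trans (h2.trans (lintegral_mono fun s => ?_))
      rw [enorm_mul, ← mul_assoc 2]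
      gcongr
      · rw [Real.enorm_eq_ofReal zero_le_two, ENNReal.ofReal_ofNat]
      · exact Real.ofReal_le_enorm _
      · exact le_iSup₂ (f := fun s' (_ : s' ≤ s) => hausdorffMNC (Set.range fun n => x n s'))
          s le_rfl
    · rw [enorm_le_iff_norm_le]
      exact (hs n).trans (Real.le_norm_self _)

theorem exists_tendsto_subseq (hx : IsApproxSolution p F k θ h x w)
    (hF : MultimapHypotheses p F) (hk : KernelHypotheses q k) (hh : Tendsto h atTop (𝓝 h₀)) :
    ∃ x₀ : C(Segment T, E), ∃ ψ : ℕ → ℕ, StrictMono ψ ∧ Tendsto (x ∘ ψ) atTop (𝓝 x₀) := by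
  have : T2Space (UniformOnFun (Segment T) E {K | IsCompact K}) :=
    UniformOnFun.t2Space_of_covering
      (Set.eq_univ_of_forall fun t => ⟨{t}, isCompact_singleton, rfl⟩)
  have hcpt : IsCompact (closure (Set.range x)) := by
    refine ArzelaAscoli.isCompact_closure_of_isClosedEmbedding (F := fun f : C(Segment T, E) => ⇑f)
      (𝔖 := {K | IsCompact K}) (fun K hK => hK)
      ContinuousMap.isUniformEmbedding_toUniformOnFunIsCompact.isClosedEmbedding ?_ ?_
    · intro K _
      refine Equicontinuous.equicontinuousOn ?_ K
      have := (hx.uniformEquicontinuous hF hk hh).equicontinuous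
      intro t U hU
      filter_upwards [this t U hU] with s hs
      rintro ⟨_, n, rfl⟩
      exact hs n
    · intro K _ t _
      refine ⟨closure (Set.range fun n => x n t),
        (hx.totallyBounded_range_apply hF hk hh t).closure.isCompact_of_isClosed
          isClosed_closure, ?_⟩
      rintro _ ⟨n, rfl⟩
      exact subset_closure ⟨n, rfl⟩
  obtain ⟨x₀, _, ψ, hψ, h⟩ := hcpt.tendsto_subseq fun n => subset_closure ⟨n, rfl⟩
  exact ⟨x₀, ψ, hψ, h⟩

/-- A uniform limit of approximate solutions is a solution. The selections have relatively compact
values almost everywhere, so convex combinations of their tails converge almost everywhere; the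
limit is a selection along the limit trajectory, by upper hemicontinuity, and the integral equation
survives by dominated convergence. -/
theorem mem_solutionSet_of_tendsto (hx : IsApproxSolution p F k θ h x w)
    (hF : MultimapHypotheses p F) (hk : KernelHypotheses q k) (hh : Tendsto h atTop (𝓝 h₀))
    {x₀ : C(Segment T, E)} (hx₀ : Tendsto x atTop (𝓝 x₀)) : x₀ ∈ solutionSet p F k h₀ := by
  obtain ⟨g, hg, hwg⟩ := hx.exists_dominating hF hk hh
  obtain ⟨η, -, hη⟩ := hF.compactness
  have htb : ∀ᵐ s, TotallyBounded (Set.range fun n => w n s) := by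
    filter_upwards [hx.ae_hausdorffMNC_le hF hk hh hη] with s hs
    rwa [hausdorffMNC_eq_zero_iff.2 (hx.totallyBounded_range_apply hF hk hh s), mul_zero,
      nonpos_iff_eq_zero, hausdorffMNC_eq_zero_iff] at hs
  obtain ⟨c, hc, z, hz, hlim⟩ := exists_ae_tendsto_combo (fun n => (hx.memLp n).1)
    hg.1.aemeasurable hwg htb
  have hcombo_le : ∀ᵐ s, ∀ n, ‖combo (c n) fun m => w m s‖ ≤ g s := by
    filter_upwards [hwg] with s hs n
    simpa using hc.combo_mem (convex_closedBall (0 : E) (g s)) n fun m _ => by simpa using hs m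
  have hzp : MemLp z p volume := by
    refine hg.mono hz ?_
    filter_upwards [hlim, hcombo_le] with s h1 h2
    exact (le_of_tendsto' h1.norm h2).trans (Real.le_norm_self _)
  obtain ⟨d, hd, hθd⟩ := hx.delay_tendsto
  have hθ : ∀ t, Tendsto (fun n => x n (θ n t)) atTop (𝓝 (x₀ t)) := fun t => by
    have h1 : Tendsto (fun n => θ n t) atTop (𝓝 t) :=
      tendsto_iff_dist_tendsto_zero.2
        (squeeze_zero (fun _ => dist_nonneg) (fun n => hθd n t) hd)
    exact (continuous_eval.tendsto (x₀, t)).comp (hx₀.prodMk_nhds h1)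
  refine ⟨hzp.toLp z, ?_, fun t => ?_⟩
  · filter_upwards [hzp.coeFn_toLp, hlim, hF.upperHemicontinuous, ae_all_iff.2 hx.mem] with
      t h1 h2 h3 h4
    rw [h1]
    exact h3.mem_of_tendsto_combo (hF.convex _ _) (hF.isClosed _ _) (hθ t) h4 hc h2
  · rw [volterra_congr_of_ae_le (w := z) (hzp.coeFn_toLp.mono fun s hs _ => hs)]
    have hev : ∀ {f : ℕ → C(Segment T, E)} {f₀}, Tendsto f atTop (𝓝 f₀) →
        Tendsto (fun n => combo (c n) fun m => f m t) atTop (𝓝 (f₀ t)) := fun hf =>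
      hc.tendsto_combo (((ContinuousEvalConst.continuous_eval_const t).tendsto _).comp hf)
    have hint : Tendsto (fun n => ∫ s, kernelSection k t s (combo (c n) fun m => w m s)) atTop
        (𝓝 (volterra k z t)) := by
      rw [volterra_eq_integral]
      refine tendsto_integral_of_dominated_convergence (fun s => ‖kernelSection k t s‖ * g s)
        (fun n => ?_) ?_ (fun n => ?_) ?_
      · exact (ContinuousLinearMap.id ℝ (E →L[ℝ] E)).aestronglyMeasurable_comp₂
          (hk.memLp_kernelSection t).1
          (Finset.aestronglyMeasurable_fun_sum _ fun m _ => ((hx.memLp m).1.const_smul _))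
      · exact memLp_one_iff_integrable.1 (hg.mul (hk.memLp_kernelSection t).norm)
      · filter_upwards [hcombo_le] with s hs
        exact ((kernelSection k t s).le_opNorm _).trans (by gcongr; exact hs n)
      · filter_upwards [hlim] with s hs
        exact ((kernelSection k t s).continuous.tendsto _).comp hs
    refine tendsto_nhds_unique (hev hx₀) (((hev hh).add hint).congr fun n => ?_)
    have h1 : ∫ s, kernelSection k t s (combo (c n) fun m => w m s) =
        combo (c n) fun m => volterra k (w m) t := by
      simp only [combo, map_sum, map_smul, volterra_eq_integral]
      rw [integral_finsetSum (f := fun m s => c n m • kernelSection k t s (w m s)) _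
        fun m _ => (hk.integrable_apply (hx.memLp m) t).smul _]
      simp only [integral_smul]
    rw [h1]
    simp only [combo, hx.eq_add _ t, smul_add, Finset.sum_add_distrib]

end IsApproxSolution

end Compactness

/-! ### Delayed solutions -/

section Existence

variable {E : Type*} [NormedAddCommGroup E] [NormedSpace ℝ E] {T : ℝ}

/-- The last point of the grid `δ ℕ` that is not beyond `t`. -/
noncomputable def gridFloor {δ : ℝ} (hδ : 0 < δ) (t : Segment T) : Segment T :=
  ⟨⌊(t : ℝ) / δ⌋₊ * δ, by positivity,
    ((le_div_iff₀ hδ).1 (Nat.floor_le (div_nonneg t.2.1 hδ.le))).trans t.2.2⟩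

theorem gridFloor_le {δ : ℝ} (hδ : 0 < δ) (t : Segment T) : gridFloor hδ t ≤ t :=
  Subtype.coe_le_coe.1 ((le_div_iff₀ hδ).1 (Nat.floor_le (div_nonneg t.2.1 hδ.le)))

theorem dist_gridFloor_le {δ : ℝ} (hδ : 0 < δ) (t : Segment T) : dist (gridFloor hδ t) t ≤ δ := by
  have h1 : (gridFloor hδ t : ℝ) ≤ t := gridFloor_le hδ t
  have h2 : (t : ℝ) < (⌊(t : ℝ) / δ⌋₊ + 1) * δ := (div_lt_iff₀ hδ).1 (Nat.lt_floor_add_one _)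
  rw [Subtype.dist_eq, Real.dist_eq, abs_sub_comm, abs_of_nonneg (sub_nonneg.2 h1)]
  simp only [gridFloor]
  linarith

variable {p q : ℝ≥0∞} {F : Segment T → E → Set E} {k : Segment T → Segment T → E →L[ℝ] E}

theorem MultimapHypotheses.exists_memLp_selection (hF : MultimapHypotheses p F) (y : E) :
    ∃ v : Segment T → E, MemLp v p volume ∧ ∀ t, v t ∈ F t y := by
  obtain ⟨v, hv, hvF⟩ := hF.selection y
  obtain ⟨c, hc, hgrowth⟩ := hF.growth
  exact ⟨v, (hc.mul_const (1 + ‖y‖)).mono' hv (hgrowth.mono fun t ht => ht y _ (hvF t)), hvF⟩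

/-- Tonelli's delayed scheme: on each grid interval `[n δ, (n + 1) δ)` the delayed trajectory is
constant, with a value that only depends on the selection made before, so that a measurable
selection of `F(·, y)` for a single `y` extends the construction. -/
theorem exists_delayed_selection_step (hF : MultimapHypotheses p F) (h : C(Segment T, E)) {δ : ℝ}
    (hδ : 0 < δ) (n : ℕ) :
    ∃ w : Segment T → E, MemLp w p volume ∧ ∀ᵐ t : Segment T, (t : ℝ) < n * δ →
      w t ∈ F t (h (gridFloor hδ t) + volterra k w (gridFloor hδ t)) := by
  induction n with
  | zero =>
    refine ⟨0, MemLp.zero, Eventually.of_forall fun t ht => ?_⟩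
    rw [Nat.cast_zero, zero_mul] at ht
    exact absurd ht t.2.1.not_gt
  | succ n ih =>
    obtain ⟨w, hw, hwF⟩ := ih
    by_cases hn : n * δ ≤ T
    · let τ : Segment T := ⟨n * δ, by positivity, hn⟩
      obtain ⟨v, hv, hvF⟩ := hF.exists_memLp_selection (h τ + volterra k w τ)
      classical
      let w' : Segment T → E := (Set.Iio τ).piecewise w v
      have hlt : ∀ {t}, t < τ → w' t = w t := fun ht =>
        Set.piecewise_eq_of_mem _ _ _ ht
      have hV : ∀ s ≤ τ, volterra k w' s = volterra k w s := fun s hs => by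
        refine volterra_congr_of_ae_le ?_
        filter_upwards [compl_mem_ae_iff.2 (volume_segment_singleton τ)] with r hr hrs
        exact hlt (lt_of_le_of_ne (hrs.trans hs) hr)
      refine ⟨w', MemLp.piecewise measurableSet_Iio (hw.restrict _) (hv.restrict _), ?_⟩
      filter_upwards [hwF] with t ht htn
      rcases lt_or_ge t τ with htτ | htτ
      · rw [hlt htτ, hV _ ((gridFloor_le hδ t).trans htτ.le)]
        exact ht htτ
      · have hfloor : gridFloor hδ t = τ := by
          have : ⌊(t : ℝ) / δ⌋₊ = n := by
            rw [Nat.floor_eq_iff (div_nonneg t.2.1 hδ.le), le_div_iff₀ hδ, div_lt_iff₀ hδ]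
            exact ⟨htτ, by exact_mod_cast htn⟩
          simp only [gridFloor, this, τ]
        rw [hfloor, hV τ le_rfl, show w' t = v t from Set.piecewise_eq_of_notMem _ _ _ htτ.not_gt]
        exact hvF t
    · exact ⟨w, hw, hwF.mono fun t ht _ => ht (t.2.2.trans_lt (not_le.1 hn))⟩

theorem exists_delayed_selection (hF : MultimapHypotheses p F) (h : C(Segment T, E)) {δ : ℝ}
    (hδ : 0 < δ) :
    ∃ w : Segment T → E, MemLp w p volume ∧
      ∀ᵐ t, w t ∈ F t (h (gridFloor hδ t) + volterra k w (gridFloor hδ t)) := by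
  obtain ⟨n, hn⟩ := exists_nat_gt (T / δ)
  obtain ⟨w, hw, hwF⟩ := exists_delayed_selection_step (k := k) hF h hδ n
  exact ⟨w, hw, hwF.mono fun t ht => ht (t.2.2.trans_lt ((div_lt_iff₀ hδ).1 hn))⟩

variable [ENNReal.HolderConjugate q p] [Fact (1 ≤ q)]

theorem exists_isApproxSolution (hF : MultimapHypotheses p F) (hk : KernelHypotheses q k)
    (h : C(Segment T, E)) : ∃ θ x w, IsApproxSolution p F k θ (fun _ => h) x w := by
  choose w hw hwF using fun n : ℕ => exists_delayed_selection (k := k) hF h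
    (Nat.one_div_pos_of_nat (α := ℝ) (n := n))
  exact ⟨fun n => gridFloor Nat.one_div_pos_of_nat,
    fun n => ⟨fun t => h t + volterra k (w n) t, h.continuous.add (hk.continuous_volterra (hw n))⟩,
    w, hw, fun _ _ => rfl, fun _ => gridFloor_le _,
    ⟨_, tendsto_one_div_add_atTop_nhds_zero_nat, fun _ => dist_gridFloor_le _⟩, hwF⟩

variable [CompleteSpace E]

theorem solutionSet_nonempty (hF : MultimapHypotheses p F) (hk : KernelHypotheses q k)
    (h : C(Segment T, E)) : (solutionSet p F k h).Nonempty := by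
  obtain ⟨θ, x, w, hx⟩ := exists_isApproxSolution hF hk h
  obtain ⟨x₀, ψ, hψ, hlim⟩ := hx.exists_tendsto_subseq hF hk tendsto_const_nhds
  exact ⟨x₀, (hx.comp hψ).mem_solutionSet_of_tendsto hF hk tendsto_const_nhds hlim⟩

theorem isUpperSemicontinuous_solutionSet (hF : MultimapHypotheses p F)
    (hk : KernelHypotheses q k) : IsUpperSemicontinuous (solutionSet p F k) := by
  intro A hA
  rw [← isClosed_compl_iff]
  refine IsSeqClosed.isClosed fun h h₀ hh hlim => ?_
  choose x hxS hxA using fun n => Set.not_subset.1 (hh n)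
  choose w hwF hxw using hxS
  have hx : IsApproxSolution p F k (fun _ => id) h x fun n => w n :=
    ⟨fun n => Lp.memLp (w n), hxw, fun _ _ => le_rfl,
      ⟨fun _ => 0, tendsto_const_nhds, fun _ t => (dist_self t).le⟩, hwF⟩
  obtain ⟨x₀, ψ, hψ, hxlim⟩ := hx.exists_tendsto_subseq hF hk hlim
  have hx₀ := (hx.comp hψ).mem_solutionSet_of_tendsto hF hk (hlim.comp hψ.tendsto_atTop) hxlim
  exact fun hsub => hA.isClosed_compl.mem_of_tendsto hxlim
    (Eventually.of_forall fun n => hxA (ψ n)) (hsub hx₀)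

end Existence

end VolterraInclusion

theorem mainTheorem8 {E : Type*} [NormedAddCommGroup E] [NormedSpace ℝ E] [CompleteSpace E]
    {T : ℝ} (hT : 0 < T) {p q : ℝ≥0∞} (hp : 1 ≤ p) (hp_top : p ≠ ∞) (hpq : p⁻¹ + q⁻¹ = 1)
    (F : VolterraInclusion.Segment T → E → Set E)
    (hF : VolterraInclusion.MultimapHypotheses p F)
    (k : VolterraInclusion.Segment T → VolterraInclusion.Segment T → E →L[ℝ] E)
    (hk : VolterraInclusion.KernelHypotheses q k) :
    (∀ h, (VolterraInclusion.solutionSet p F k h).Nonempty) ∧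
      VolterraInclusion.IsUpperSemicontinuous (VolterraInclusion.solutionSet p F k) := by
  have : ENNReal.HolderConjugate q p := ENNReal.holderConjugate_iff.2 (by rw [add_comm, hpq])
  have : Fact (1 ≤ q) := ⟨ENNReal.inv_le_one.1 (hpq ▸ le_add_self)⟩
  exact ⟨VolterraInclusion.solutionSet_nonempty hF hk,
    VolterraInclusion.isUpperSemicontinuous_solutionSet hF hk⟩
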